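/- A (binary) CSS code on $n$ qubits is given by two parity check matrices $A^X, A^Z$ over $\mathbb{F}_2$ with $n$ columns and $A^X (A^Z)^T=0$. Let $C^X, C^Z\subseteq\mathbb{F}_2^n$ be their row spaces. The code has parameters $[[n,k,d,w]]$ if $k=n-\dim C^X-\dim C^Z$, if $d$ is the minimum Hamming weight of the vectors in $\big((C^X)^\perp\setminus C^Z\big)\cup\big((C^Z)^\perp\setminus C^X\big)$ (both sets being non-empty), and if every row and every column of $A^X$ and of $A^Z$ has at most $w$ non-zero entries. A complex of size $M$ is an $M\times M$ matrix $\delta$ over $\mathbb{F}_2$ with $\delta^2=0$; its homological dimension is $\dim(\ker\delta/\operatorname{im}\delta)$, and its code has $A^X=\delta$, $A^Z=\delta^T$. The (single-sector) homological product of $\delta_1$ and $\delta_2$ is the complex $\partial=\delta_1\otimes I+I\otimes\delta_2$. **Theorem.** There are constants $c_1,c_2,c_3>0$ such that the following two statements hold. 1. For all sufficiently large $n$ there is a quantum CSS code with parameters $[[n,k,d,w]]$, where $k\ge c_1 n$, $d\ge c_2 n$ and $w\le c_3\sqrt n$. 2. For lengths $n=M^2$ such codes arise as homological products of two random complexes of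 size $M=\sqrt n$. That is, there are a constant $\rho>0$ and integers $H(M)\ge 0$ with $H(M)/M\to\rho$ as $M\to\infty$ and $H(M)^2\ge c_1M^2$ for all large $M$, such that the following holds. Let $\delta_1,\delta_2$ be independent and uniformly distributed on the set of complexes of size $M$ with homological dimension $H(M)$ (a non-empty set for all large $M$). Then, with probability tending to $1$ as $M\to\infty$, the code of the product of $\delta_1$ and $\delta_2$ has parameters $[[M^2,H(M)^2,d,w]]$ with $d\ge c_2M^2$ and $w\le c_3M$. -/

import Mathlib

open Filter Topology
open scoped Kronecker

/-- Orthogonal complement of a binary linear code with respect to the standard binary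
inner product `(f, g) = ∑ p, f p * g p`. -/
def binaryPerp {Q : Type*} [Fintype Q] (C : Submodule (ZMod 2) (Q → ZMod 2)) :
    Submodule (ZMod 2) (Q → ZMod 2) where
  carrier := {v | ∀ f ∈ C, v ⬝ᵥ f = 0}
  add_mem' := by
    intro a b ha hb f hf
    rw [add_dotProduct, ha f hf, hb f hf, add_zero]
  zero_mem' := by
    intro f _
    exact zero_dotProduct f
  smul_mem' := by
    intro c a ha f hf
    rw [smul_dotProduct, ha f hf, smul_zero]

/-- A CSS code on the set of qubits `Q`, given by a pair of binary parity check matrices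
`AX`, `AZ` (with rows indexed by `RX`, `RZ`), every row of `AX` being orthogonal to
every row of `AZ`. -/
structure CSSCode (RX RZ Q : Type*) [Fintype Q] where
  /-- the `X`-type parity check matrix -/
  AX : Matrix RX Q (ZMod 2)
  /-- the `Z`-type parity check matrix -/
  AZ : Matrix RZ Q (ZMod 2)
  orthogonal : AX * AZ.transpose = 0

namespace CSSCode

variable {RX RZ Q : Type*} [Fintype RX] [Fintype RZ] [Fintype Q]

/-- `C^X`: the span of the rows of `AX`. -/
def CX (C : CSSCode RX RZ Q) : Submodule (ZMod 2) (Q → ZMod 2) :=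
  Submodule.span (ZMod 2) (Set.range fun i => C.AX i)

/-- `C^Z`: the span of the rows of `AZ`. -/
def CZ (C : CSSCode RX RZ Q) : Submodule (ZMod 2) (Q → ZMod 2) :=
  Submodule.span (ZMod 2) (Set.range fun i => C.AZ i)

/-- `d` is the minimum weight of the vectors in `(C^X)^⊥ \ C^Z`. -/
def IsDistanceZ (C : CSSCode RX RZ Q) (d : ℕ) : Prop :=
  IsLeast {m : ℕ | ∃ v : Q → ZMod 2, v ∈ binaryPerp C.CX ∧ v ∉ C.CZ ∧ hammingNorm v = m} d

/-- `d` is the minimum weight of the vectors in `(C^Z)^⊥ \ C^X`. -/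
def IsDistanceX (C : CSSCode RX RZ Q) (d : ℕ) : Prop :=
  IsLeast {m : ℕ | ∃ v : Q → ZMod 2, v ∈ binaryPerp C.CZ ∧ v ∉ C.CX ∧ hammingNorm v = m} d

/-- Stabilizer weight `w`: any row and any column of `AX` and `AZ` has at most `w`
non-zero entries. -/
def HasStabilizerWeight (C : CSSCode RX RZ Q) (w : ℕ) : Prop :=
  (∀ i, hammingNorm (fun q => C.AX i q) ≤ w) ∧ (∀ q, hammingNorm (fun i => C.AX i q) ≤ w) ∧
  (∀ i, hammingNorm (fun q => C.AZ i q) ≤ w) ∧ (∀ q, hammingNorm (fun i => C.AZ i q) ≤ w)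

/-- The code has parameters `[[n, k, d, w]]`: there are `n` qubits,
`k = n - dim C^X - dim C^Z` logical qubits, the distance is `d = min {d^X, d^Z}`, and
the stabilizer weight is `w`. -/
def HasParameters (C : CSSCode RX RZ Q) (n k d w : ℕ) : Prop :=
  Fintype.card Q = n ∧
  k + Module.finrank (ZMod 2) C.CX + Module.finrank (ZMod 2) C.CZ = n ∧
  (∃ dX dZ : ℕ, C.IsDistanceX dX ∧ C.IsDistanceZ dZ ∧ d = min dX dZ) ∧
  C.HasStabilizerWeight w

end CSSCode

/-- A single-sector complex: the binary space with standard basis `Q`, together with a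
boundary operator, a square matrix `δ` with `δ² = 0`. -/
structure BinaryComplex (Q : Type*) [Fintype Q] where
  δ : Matrix Q Q (ZMod 2)
  sq_zero : δ * δ = 0

namespace BinaryComplex

variable {Q Q₁ Q₂ : Type*} [Fintype Q] [Fintype Q₁] [Fintype Q₂]

/-- The homological dimension `dim (ker δ / im δ)`. -/
noncomputable def homDim (K : BinaryComplex Q) : ℕ :=
  Module.finrank (ZMod 2)
    (LinearMap.ker K.δ.mulVecLin ⧸
      (LinearMap.range K.δ.mulVecLin).submoduleOf (LinearMap.ker K.δ.mulVecLin))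

/-- The CSS code of a single-sector complex, with parity check matrices `A^X = δ` and
`A^Z = δᵀ`. -/
def code (K : BinaryComplex Q) : CSSCode Q Q Q where
  AX := K.δ
  AZ := K.δ.transpose
  orthogonal := by rw [Matrix.transpose_transpose, K.sq_zero]

/-- The single-sector homological product, with boundary operator `δ₁ ⊗ I + I ⊗ δ₂`
in the product basis. -/
def prod [DecidableEq Q₁] [DecidableEq Q₂] (K₁ : BinaryComplex Q₁) (K₂ : BinaryComplex Q₂) :
    BinaryComplex (Q₁ × Q₂) where
  δ := K₁.δ ⊗ₖ (1 : Matrix Q₂ Q₂ (ZMod 2)) + (1 : Matrix Q₁ Q₁ (ZMod 2)) ⊗ₖ K₂.δ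
  sq_zero := by
    simp only [add_mul, mul_add, ← Matrix.mul_kronecker_mul, K₁.sq_zero, K₂.sq_zero, one_mul,
      mul_one, Matrix.zero_kronecker, Matrix.kronecker_zero, zero_add, add_zero]
    exact ZModModule.add_self _

end BinaryComplex

/-- The complexes of dimension `M` and homological dimension `H`. -/
abbrev ComplexWithHomDim (M H : ℕ) : Type :=
  {K : BinaryComplex (Fin M) // K.homDim = H}

/-- The probability that the homological product of two independent complexes, each
uniformly distributed on `ComplexWithHomDim M H`, has the property `P`. It is `0` when
there is no such complex. -/
noncomputable def productProbability (M H : ℕ)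
    (P : BinaryComplex (Fin M × Fin M) → Prop) : ℝ :=
  (Nat.card {K : ComplexWithHomDim M H × ComplexWithHomDim M H //
      P (K.1.val.prod K.2.val)} : ℝ) /
    (Nat.card (ComplexWithHomDim M H × ComplexWithHomDim M H) : ℝ)

/-! Write a chain of the product of complexes `A`, `D` as an M × M matrix X. It is a cycle when AX +
XDᵀ = 0 and a boundary when X = AY + YDᵀ for some Y. If X has weight below (a+1)², with a a small
multiple of M, then at most a rows (the set R) and at most a columns (the set C) have weight above
a. Erasing them leaves a matrix T all of whose rows and columns have weight at most a.

If T = 0, then X lives on a thin cross, and it is a boundary as soon as neither A nor D sends a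
nonzero light vector to a light vector (`exists_eq_of_cross_supported`). If T has rank r ≥ 1,
consider row vectors z annihilating F^R + A F^R. Such z vanish on R, so zX and zT agree outside C;
since A² = 0, the same holds for zA. The cycle equation D(zX) = (zA)X then prescribes D, up to light
errors on C, on the vectors zX. For typical A there are q = ⌈r/2⌉ such z with independent zT
(`exists_detects`).

This is rare by a union bound. Let 2^b bound the number of light vectors. T is determined by r of
its rows and r of its columns, hence by 4br bits, and the errors and R cost b + 2bq more.
Prescribing a random square-zero matrix on q independent vectors has probability at most 2^(-24bq)
(`card_prescribed_mul_le`). Both exponents are linear in the rank, so every rank is beaten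
(`ncard_hasSparseIntertwiner_le`), and distances of order M² follow.

Transposition handles the dual distance, the Künneth formula gives dimension H², and padding by
trivially stabilized qubits reaches lengths that are not squares. -/

/-! ### Random square-zero matrices with prescribed values -/

/-- Any two linearly independent families of the same shape are related by an automorphism. -/
theorem LinearIndependent.exists_linearEquiv_apply_eq {K V ι : Type*} [Field K] [AddCommGroup V]
    [Module K V] [FiniteDimensional K V] {v w : ι → V}
    (hv : LinearIndependent K v) (hw : LinearIndependent K w) :
    ∃ e : V ≃ₗ[K] V, ∀ i, e (v i) = w i := by
  obtain ⟨p, hp⟩ := Submodule.exists_isCompl (Submodule.span K (Set.range v))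
  obtain ⟨q, hq⟩ := Submodule.exists_isCompl (Submodule.span K (Set.range w))
  let e₁ : Submodule.span K (Set.range v) ≃ₗ[K] Submodule.span K (Set.range w) :=
    (Module.Basis.span hv).equiv (Module.Basis.span hw) (Equiv.refl ι)
  have h₁ := Submodule.finrank_add_eq_of_isCompl hp
  have h₂ := Submodule.finrank_add_eq_of_isCompl hq
  have h₃ := e₁.finrank_eq
  let e₂ : p ≃ₗ[K] q := LinearEquiv.ofFinrankEq p q (by omega)
  refine ⟨(Submodule.prodEquivOfIsCompl _ _ hp).symm ≪≫ₗ (e₁.prodCongr e₂) ≪≫ₗ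
    Submodule.prodEquivOfIsCompl _ _ hq, fun i => ?_⟩
  have hi : v i = ((Module.Basis.span hv i : Submodule.span K (Set.range v)) : V) := by
    rw [Module.Basis.span_apply]
  have he₁ : e₁ (Module.Basis.span hv i) = Module.Basis.span hw i := by
    simp only [e₁, Module.Basis.equiv_apply, Equiv.refl_apply]
  rw [hi]
  simp only [LinearEquiv.trans_apply, Submodule.prodEquivOfIsCompl_symm_apply_left,
    LinearEquiv.prodCongr_apply, map_zero, Submodule.coe_prodEquivOfIsCompl',
    ZeroMemClass.coe_zero, add_zero]
  rw [he₁, Module.Basis.span_apply]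

/-- The square-zero binary matrices of size `M` and rank `L`. -/
def squareZeroMatrices (M L : ℕ) : Set (Matrix (Fin M) (Fin M) (ZMod 2)) :=
  {A | A * A = 0 ∧ A.rank = L}

theorem mem_squareZeroMatrices {M L : ℕ} {A : Matrix (Fin M) (Fin M) (ZMod 2)} :
    A ∈ squareZeroMatrices M L ↔ A * A = 0 ∧ A.rank = L := Iff.rfl

theorem conj_mem_squareZeroMatrices {M L : ℕ} {A U W : Matrix (Fin M) (Fin M) (ZMod 2)}
    (hWU : W * U = 1) (hA : A ∈ squareZeroMatrices M L) :
    U * A * W ∈ squareZeroMatrices M L := by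
  rw [mem_squareZeroMatrices] at hA ⊢
  have hUW : U * W = 1 := mul_eq_one_comm.mp hWU
  refine ⟨?_, ?_⟩
  · calc U * A * W * (U * A * W) = U * A * (W * U) * A * W := by simp only [Matrix.mul_assoc]
      _ = 0 := by rw [hWU, Matrix.mul_one, Matrix.mul_assoc U, hA.1]; simp
  · have hU : IsUnit U.det := by
      rw [← Matrix.isUnit_iff_isUnit_det]; exact IsUnit.of_mul_eq_one W hUW
    have hW : IsUnit W.det := by
      rw [← Matrix.isUnit_iff_isUnit_det]; exact IsUnit.of_mul_eq_one U hWU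
    rw [Matrix.rank_mul_eq_left_of_isUnit_det _ _ hW,
      Matrix.rank_mul_eq_right_of_isUnit_det _ _ hU, hA.2]

/-- Double counting over the orbit of all linearly independent families. -/
theorem card_filter_mul_card_linearIndependent_le {M L : ℕ} {ι : Type*} [Fintype ι]
    (Φ : Matrix (Fin M) (Fin M) (ZMod 2) → (ι → Fin M → ZMod 2) → Prop)
    (hΦ : ∀ U W : Matrix (Fin M) (Fin M) (ZMod 2), W * U = 1 → ∀ A w, Φ A w →
      Φ (U * A * W) fun i => U.mulVec (w i))
    (w : ι → Fin M → ZMod 2) (hw : LinearIndependent (ZMod 2) w) (c : ℕ)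
    (hc : ∀ A ∈ squareZeroMatrices M L,
      {w' : ι → Fin M → ZMod 2 | Φ A w'}.ncard ≤ c) :
    {A ∈ squareZeroMatrices M L | Φ A w}.ncard *
      Nat.card {w' : ι → Fin M → ZMod 2 // LinearIndependent (ZMod 2) w'} ≤
    (squareZeroMatrices M L).ncard * c := by
  classical
  rw [Nat.card_eq_fintype_card, Fintype.card_subtype, mul_comm, Set.ncard_eq_toFinset_card',
    Set.ncard_eq_toFinset_card']
  refine Finset.card_mul_le_card_mul (fun w' A => Φ A w') ?_ ?_
  · intro w' hw'
    -- Conjugation by an automorphism carrying `w` to `w'` preserves the ensemble and the relation,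
    -- so `w'` is related to at least as many matrices as `w`.
    obtain ⟨e, he⟩ := hw.exists_linearEquiv_apply_eq (Finset.mem_filter.mp hw').2
    set U := LinearMap.toMatrix' (e : (Fin M → ZMod 2) →ₗ[ZMod 2] (Fin M → ZMod 2)) with hU
    set W := LinearMap.toMatrix' (e.symm : (Fin M → ZMod 2) →ₗ[ZMod 2] (Fin M → ZMod 2)) with hW
    have hWU : W * U = 1 := by
      rw [hU, hW, ← LinearMap.toMatrix'_comp]; simp
    have hUW : U * W = 1 := mul_eq_one_comm.mp hWU
    refine Finset.card_le_card_of_injOn (fun A => U * A * W) ?_ ?_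
    · intro A hA
      have hA' : A ∈ squareZeroMatrices M L ∧ Φ A w := by simpa using hA
      rw [Finset.mem_coe, Finset.mem_bipartiteAbove, Set.mem_toFinset]
      refine ⟨conj_mem_squareZeroMatrices hWU hA'.1, ?_⟩
      have := hΦ U W hWU A w hA'.2
      convert this using 2 with i
      rw [hU, LinearMap.toMatrix'_mulVec, ← he i]; rfl
    · intro A _ B _ hAB
      have h : W * (U * A * W) * U = W * (U * B * W) * U := by
        simp only at hAB; rw [hAB]
      have aux : ∀ C : Matrix (Fin M) (Fin M) (ZMod 2), W * (U * C * W) * U = C := by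
        intro C
        calc W * (U * C * W) * U = (W * U) * C * (W * U) := by simp only [Matrix.mul_assoc]
          _ = C := by rw [hWU]; simp
      rwa [aux, aux] at h
  · intro A hA
    refine le_trans ?_ (hc A (by simpa using hA))
    rw [Set.ncard_eq_toFinset_card']
    refine Finset.card_le_card fun w' hw' => ?_
    simpa using (Finset.mem_filter.mp hw').2

/-- The i-th vector has 2^M - 2^i choices, and i ≤ M - 1 makes this at least 2^(M-1). -/
theorem two_pow_le_card_linearIndependent {M k : ℕ} (hk : k ≤ M) :
    2 ^ ((M - 1) * k) ≤
      Nat.card {w : Fin k → Fin M → ZMod 2 // LinearIndependent (ZMod 2) w} := by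
  rw [card_linearIndependent (by simpa using hk)]
  simp only [ZMod.card, Module.finrank_fintype_fun_eq_card, Fintype.card_fin]
  rw [pow_mul, ← Fin.prod_const k (2 ^ (M - 1))]
  refine Finset.prod_le_prod' fun i _ => ?_
  have hi := i.isLt
  have h1 : 2 ^ (i : ℕ) ≤ 2 ^ (M - 1) := Nat.pow_le_pow_right (by norm_num) (by omega)
  have h2 : 2 ^ M = 2 ^ (M - 1) * 2 := by rw [← pow_succ]; congr 1; omega
  omega

theorem card_ker_mulVec {M L : ℕ} {A : Matrix (Fin M) (Fin M) (ZMod 2)} (hA : A.rank = L) :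
    Nat.card {v : Fin M → ZMod 2 // A.mulVec v = 0} = 2 ^ (M - L) := by
  have h : Nat.card (LinearMap.ker A.mulVecLin) = 2 ^ (M - L) := by
    rw [Module.natCard_eq_pow_finrank (K := ZMod 2)]
    have := LinearMap.finrank_range_add_finrank_ker A.mulVecLin
    rw [Matrix.rank] at hA
    simp only [Module.finrank_fintype_fun_eq_card, Fintype.card_fin] at this
    rw [Nat.card_eq_fintype_card, ZMod.card]
    congr 1; omega
  exact h

/-- A kernel of dimension M - L contains at most 2^((M-L)k) families of length k, against at least
2^((M-1)k) independent ones; the double count leaves the exponent (L-1)k. -/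
theorem card_annihilating_mul_le {M L k : ℕ} (u : Fin k → Fin M → ZMod 2)
    (hu : LinearIndependent (ZMod 2) u) (hL : 1 ≤ L) (hLM : L ≤ M) :
    {A ∈ squareZeroMatrices M L | ∀ i, A.mulVec (u i) = 0}.ncard *
      2 ^ ((L - 1) * k) ≤ (squareZeroMatrices M L).ncard := by
  have hk : k ≤ M := by simpa using hu.fintype_card_le_finrank
  have key := card_filter_mul_card_linearIndependent_le (L := L)
    (fun A (w : Fin k → Fin M → ZMod 2) => ∀ i, A.mulVec (w i) = 0) ?_ u hu
    (2 ^ ((M - L) * k)) ?_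
  · have h1 := (Nat.mul_le_mul_left _ (two_pow_le_card_linearIndependent hk)).trans key
    have h2 : (M - 1) * k = (L - 1) * k + (M - L) * k := by
      rw [← add_mul]; congr 1; omega
    rw [h2, pow_add, ← mul_assoc] at h1
    exact le_of_mul_le_mul_right h1 (by positivity)
  · intro U W hWU A w h i
    rw [Matrix.mulVec_mulVec, Matrix.mul_assoc, hWU, Matrix.mul_one, ← Matrix.mulVec_mulVec, h i,
      Matrix.mulVec_zero]
  · intro A hA
    rw [← Nat.card_coe_set_eq]
    refine (Nat.card_congr (Equiv.subtypePiEquivPi (p := fun _ v => A.mulVec v = 0))).le.trans ?_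
    rw [Nat.card_pi]
    simp only [card_ker_mulVec (mem_squareZeroMatrices.mp hA).2, Finset.prod_const,
      Finset.card_univ, Fintype.card_fin, pow_mul, le_refl]

/-- For a given matrix the images are determined by the `t` sources, so at most 2^(Mt) of the at
least 2^(2(M-1)t) independent families of length 2t are compatible with it. Independence of sources
and targets together puts all these families in one orbit. -/
theorem card_mapping_mul_le {M L t : ℕ} (u w : Fin t → Fin M → ZMod 2)
    (hu : LinearIndependent (ZMod 2) (Sum.elim u w)) :
    {A ∈ squareZeroMatrices M L | ∀ i, A.mulVec (u i) = w i}.ncard *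
      2 ^ ((M - 2) * t) ≤ (squareZeroMatrices M L).ncard := by
  have hk : t + t ≤ M := by simpa using hu.fintype_card_le_finrank
  have key := card_filter_mul_card_linearIndependent_le (L := L)
    (fun A (w : Fin t ⊕ Fin t → Fin M → ZMod 2) => ∀ i, A.mulVec (w (.inl i)) = w (.inr i)) ?_
    (Sum.elim u w) hu (2 ^ (M * t)) ?_
  · have hcard : Nat.card {w : Fin t ⊕ Fin t → Fin M → ZMod 2 // LinearIndependent (ZMod 2) w} =
        Nat.card {w : Fin (t + t) → Fin M → ZMod 2 // LinearIndependent (ZMod 2) w} := by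
      refine Nat.card_congr ((Equiv.arrowCongr finSumFinEquiv (Equiv.refl _)).subtypeEquiv ?_)
      intro a
      exact (linearIndependent_equiv finSumFinEquiv.symm).symm
    rw [hcard] at key
    have h1 := (Nat.mul_le_mul_left _ (two_pow_le_card_linearIndependent hk)).trans key
    have h2 : (M - 1) * (t + t) = (M - 2) * t + M * t := by
      rcases Nat.eq_zero_or_pos t with rfl | ht
      · simp
      · obtain ⟨m, rfl⟩ : ∃ m, M = m + 2 := ⟨M - 2, by omega⟩
        simp only [Nat.add_sub_cancel, show m + 2 - 1 = m + 1 by omega]; ring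
    rw [h2, pow_add, ← mul_assoc] at h1
    exact le_of_mul_le_mul_right h1 (by positivity)
  · intro U W hWU A w h i
    rw [Matrix.mulVec_mulVec, Matrix.mul_assoc, hWU, Matrix.mul_one, ← Matrix.mulVec_mulVec, h i]
  · intro A hA
    have : (2 : ℕ) ^ (M * t) = (Set.univ : Set (Fin t → Fin M → ZMod 2)).ncard := by
      rw [Set.ncard_univ, Nat.card_eq_fintype_card]
      simp [pow_mul]
    rw [this]
    refine Set.ncard_le_ncard_of_injOn (fun w i => w (.inl i)) (fun _ _ => Set.mem_univ _) ?_
    intro w hw w' hw' h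
    simp only [Set.mem_ofPred_eq] at hw hw'
    ext1 i
    rcases i with i | i
    · exact congrFun h i
    · rw [← hw i, ← hw' i]; exact congrArg _ (congrFun h i)

/-- Prescribing a random square-zero matrix on `r` linearly independent vectors has probability
at most `2 ^ (-N * r)`. -/
theorem card_prescribed_mul_le {M L N r : ℕ} (hN : 3 * N + 2 ≤ L) (hLM : L ≤ M)
    (g y : Fin r → Fin M → ZMod 2) (hg : LinearIndependent (ZMod 2) g) :
    {A ∈ squareZeroMatrices M L | ∀ i, A.mulVec (g i) = y i}.ncard *
      2 ^ (N * r) ≤ (squareZeroMatrices M L).ncard := by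
  rcases Set.eq_empty_or_nonempty
    {A ∈ squareZeroMatrices M L | ∀ i, A.mulVec (g i) = y i} with h0 | ⟨A₀, hA₀⟩
  · rw [h0]; simp
  obtain ⟨hA₀S, hA₀⟩ := hA₀
  have hsq := (mem_squareZeroMatrices.mp hA₀S).1
  set U := Submodule.span (ZMod 2) (Set.range g) with hU
  have hUr : Module.finrank (ZMod 2) U = r := by simpa using finrank_span_eq_card hg
  have hspan : ∀ A : Matrix (Fin M) (Fin M) (ZMod 2), (∀ i, A.mulVec (g i) = y i) →
      ∀ v ∈ U, A.mulVec v = A₀.mulVec v := by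
    intro A hA v hv
    have : Set.EqOn A.mulVecLin A₀.mulVecLin U :=
      LinearMap.eqOn_span (by rintro _ ⟨i, rfl⟩; simp [hA i, hA₀ i])
    exact this hv
  set f := A₀.mulVecLin with hf
  -- The constraint A² = 0 prevents treating the prescriptions as independent. Two kinds of
  -- directions in `U` are tractable: `K`, killed by `f`, and those that `f` moves out of `U`,
  -- counted by the rank of `φ`.
  set φ : U →ₗ[ZMod 2] ((Fin M → ZMod 2) ⧸ U) := U.mkQ ∘ₗ f ∘ₗ U.subtype with hφ
  set K := (LinearMap.ker f).comap U.subtype with hK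
  have hff : ∀ v, f (f v) = 0 := by
    intro v; simp [hf, Matrix.mulVec_mulVec, hsq]
  -- the restriction of `f` maps `ker φ` into `K` with kernel `K`
  have hdim : Module.finrank (ZMod 2) (LinearMap.ker φ) ≤ 2 * Module.finrank (ZMod 2) K := by
    have hmem : ∀ x : LinearMap.ker φ, f x.1.1 ∈ U := by
      intro x
      exact (Submodule.Quotient.mk_eq_zero U).mp x.2
    let ψ : LinearMap.ker φ →ₗ[ZMod 2] K :=
      { toFun := fun x => ⟨⟨f x.1.1, hmem x⟩, by simp [hK, hff]⟩
        map_add' := by intro x y; ext1; ext1; simp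
        map_smul' := by intro c x; ext1; ext1; simp }
    have h1 := LinearMap.finrank_range_add_finrank_ker ψ
    have h2 := Submodule.finrank_le (LinearMap.range ψ)
    have h3 : Module.finrank (ZMod 2) (LinearMap.ker ψ) ≤ Module.finrank (ZMod 2) K := by
      let θ : LinearMap.ker ψ →ₗ[ZMod 2] K :=
        { toFun := fun x => ⟨x.1.1, by
            have := x.2
            rw [LinearMap.mem_ker] at this
            exact congrArg (fun z : K => z.1.1) this⟩
          map_add' := by intro x y; rfl
          map_smul' := by intro c x; rfl }
      refine LinearMap.finrank_le_finrank_of_injective (f := θ) ?_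
      intro x y hxy
      have := congrArg (fun z : K => z.1) hxy
      ext1; ext1; exact this
    omega
  have hrn := LinearMap.finrank_range_add_finrank_ker φ
  rw [hUr] at hrn
  set t := Module.finrank (ZMod 2) (LinearMap.range φ)
  set k := Module.finrank (ZMod 2) K
  have hpow : ∀ a b : ℕ, a ≤ b → (2 : ℕ) ^ a ≤ 2 ^ b :=
    fun a b h => Nat.pow_le_pow_right (by norm_num) h
  -- From r = t + dim ker φ ≤ t + 2k, one of k, t is at least r/3. This is the factor 3 in `hN`; the
  -- summand 2 absorbs the losses in the exponents (L-1)k and (M-2)t.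
  rcases (show r ≤ 3 * k ∨ r ≤ 3 * t by omega) with h | h
  · obtain ⟨b⟩ : Nonempty (Module.Basis (Fin k) (ZMod 2) K) := ⟨Module.finBasis _ _⟩
    have hb : LinearIndependent (ZMod 2) fun i => (b i).1.1 :=
      (b.linearIndependent.map' K.subtype (Submodule.ker_subtype _)).map' U.subtype
        (Submodule.ker_subtype _)
    refine le_trans (Nat.mul_le_mul (Set.ncard_le_ncard ?_) (hpow _ ((L - 1) * k) ?_))
      (card_annihilating_mul_le _ hb (by omega) hLM)
    · intro A hA
      obtain ⟨hAS, hA⟩ := hA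
      refine ⟨hAS, fun i => ?_⟩
      rw [hspan A hA _ (b i).1.2]
      exact (b i).2
    · calc N * r ≤ N * (3 * k) := Nat.mul_le_mul_left _ h
        _ = (3 * N) * k := by ring
        _ ≤ (L - 1) * k := Nat.mul_le_mul_right _ (by omega)
  · obtain ⟨b⟩ : Nonempty (Module.Basis (Fin t) (ZMod 2) (LinearMap.range φ)) :=
      ⟨Module.finBasis _ _⟩
    choose u hu using fun i => LinearMap.mem_range.mp (b i).2
    have hb : LinearIndependent (ZMod 2) fun i => φ (u i) := by
      have h := b.linearIndependent.map' _ (Submodule.ker_subtype _)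
      rwa [show (fun i => φ (u i)) = (LinearMap.range φ).subtype ∘ b from funext hu]
    have hli : LinearIndependent (ZMod 2)
        (Sum.elim (fun i => (u i).1) fun i => f (u i).1) := by
      rw [Fintype.linearIndependent_iff] at hb ⊢
      intro c hc
      rw [Fintype.sum_sum_type] at hc
      simp only [Sum.elim_inl, Sum.elim_inr] at hc
      -- Reducing modulo `U` kills the `u`-part of the relation; what is left of it is then pushed
      -- through `f` and reduced again.
      have h1 : ∀ i, c (.inr i) = 0 := by
        refine hb _ ?_
        have := congrArg U.mkQ hc
        rw [map_add, map_zero] at this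
        have h0 : U.mkQ (∑ x, c (Sum.inl x) • (u x).1) = 0 := by
          rw [Submodule.mkQ_apply, Submodule.Quotient.mk_eq_zero]
          exact Submodule.sum_mem _ fun i _ => Submodule.smul_mem _ _ (u i).2
        rw [h0, zero_add, map_sum] at this
        simpa [hφ] using this
      have h2 : ∀ i, c (.inl i) = 0 := by
        refine hb _ ?_
        have h0 : ∑ x, c (Sum.inl x) • (u x).1 = 0 := by
          simpa [h1] using hc
        have := congrArg (fun v => U.mkQ (f v)) h0
        simpa [hφ, map_sum] using this
      rintro (i | i)
      exacts [h2 i, h1 i]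
    refine le_trans (Nat.mul_le_mul (Set.ncard_le_ncard ?_) (hpow _ ((M - 2) * t) ?_))
      (card_mapping_mul_le _ _ hli)
    · intro A hA
      obtain ⟨hAS, hA⟩ := hA
      exact ⟨hAS, fun i => hspan A hA _ (u i).2⟩
    · calc N * r ≤ N * (3 * t) := Nat.mul_le_mul_left _ h
        _ = (3 * N) * t := by ring
        _ ≤ (M - 2) * t := Nat.mul_le_mul_right _ (by omega)

/-! ### Structure of light cycles -/

/-- The binary vectors supported on `R`. -/
def supportedVectors {M : ℕ} (R : Finset (Fin M)) : Submodule (ZMod 2) (Fin M → ZMod 2) where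
  carrier := {v | ∀ i ∉ R, v i = 0}
  add_mem' := by intro v w hv hw i hi; simp [hv i hi, hw i hi]
  zero_mem' := by intro i _; rfl
  smul_mem' := by intro c v hv i hi; simp [hv i hi]

theorem hammingNorm_le_card_of_mem_supportedVectors {M : ℕ} {R : Finset (Fin M)}
    {v : Fin M → ZMod 2} (hv : v ∈ supportedVectors R) : hammingNorm v ≤ R.card := by
  refine Finset.card_le_card fun i hi => ?_
  by_contra h
  exact (Finset.mem_filter.mp hi).2 (hv i h)

theorem finrank_supportedVectors_le {M : ℕ} (R : Finset (Fin M)) :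
    Module.finrank (ZMod 2) (supportedVectors R) ≤ R.card := by
  let f : supportedVectors R →ₗ[ZMod 2] (R → ZMod 2) :=
    { toFun := fun v i => v.1 i
      map_add' := fun _ _ => rfl
      map_smul' := fun _ _ => rfl }
  have hf : Function.Injective f := by
    intro v w h
    ext i
    by_cases hi : i ∈ R
    · exact congrFun h ⟨i, hi⟩
    · rw [v.2 i hi, w.2 i hi]
  simpa using LinearMap.finrank_le_finrank_of_injective hf

theorem single_mem_supportedVectors {M : ℕ} {R : Finset (Fin M)} {i : Fin M} (hi : i ∈ R) :
    Pi.single i 1 ∈ supportedVectors R := by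
  intro j hj
  rw [Pi.single_eq_of_ne]
  rintro rfl
  exact hj hi

/-- A subspace of `(ZMod 2)^M` is its double orthogonal complement. -/
theorem mem_of_forall_dotProduct_eq_zero {M : ℕ} (K : Submodule (ZMod 2) (Fin M → ZMod 2))
    (x : Fin M → ZMod 2)
    (h : ∀ z : Fin M → ZMod 2, (∀ u ∈ K, z ⬝ᵥ u = 0) → z ⬝ᵥ x = 0) : x ∈ K := by
  by_contra hx
  obtain ⟨f, hfx, hf⟩ := Submodule.exists_le_ker_of_notMem hx
  have hdot : ∀ v, (fun i => f (Pi.single i 1)) ⬝ᵥ v = f v := by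
    intro v
    conv_rhs => rw [pi_eq_sum_univ' v, map_sum]
    refine Finset.sum_congr rfl fun i _ => ?_
    rw [map_smul, smul_eq_mul, mul_comm]
  refine hfx ?_
  rw [← hdot]
  exact h _ fun u hu => by rw [hdot]; exact hf hu

/-- No nonzero vector of weight at most `a` is mapped to a vector of weight at most `a`. -/
def SpreadsLowWeight {M : ℕ} (a : ℕ) (A : Matrix (Fin M) (Fin M) (ZMod 2)) : Prop :=
  ∀ g, g ≠ 0 → hammingNorm g ≤ a → a < hammingNorm (A.mulVec g)

/-- The subspace `F^R + A F^R`. -/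
def inflation {M : ℕ} (A : Matrix (Fin M) (Fin M) (ZMod 2)) (R : Finset (Fin M)) :
    Submodule (ZMod 2) (Fin M → ZMod 2) :=
  supportedVectors R ⊔ (supportedVectors R).map A.mulVecLin

theorem mem_inflation {M : ℕ} {A : Matrix (Fin M) (Fin M) (ZMod 2)} {R : Finset (Fin M)}
    {v : Fin M → ZMod 2} : v ∈ inflation A R ↔
      ∃ u ∈ supportedVectors R, ∃ w ∈ supportedVectors R, u + A.mulVec w = v := by
  simp [inflation, Submodule.mem_sup]

section Annihilator

variable {M : ℕ} {A : Matrix (Fin M) (Fin M) (ZMod 2)} {R : Finset (Fin M)} {z : Fin M → ZMod 2}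

theorem eq_zero_of_annihilates_inflation (hz : ∀ u ∈ inflation A R, z ⬝ᵥ u = 0) {i : Fin M}
    (hi : i ∈ R) : z i = 0 := by
  have := hz (Pi.single i 1) (Submodule.mem_sup_left (single_mem_supportedVectors hi))
  simpa using this

/-- Since A² = 0, the space F^R + A F^R is stable under A, so its annihilator is stable under z ↦
zA. -/
theorem vecMul_annihilates_inflation (hA : A * A = 0) (hz : ∀ u ∈ inflation A R, z ⬝ᵥ u = 0) :
    ∀ u ∈ inflation A R, Matrix.vecMul z A ⬝ᵥ u = 0 := by
  intro u hu
  obtain ⟨u, hu', w, hw, rfl⟩ := mem_inflation.mp hu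
  rw [← Matrix.dotProduct_mulVec, Matrix.mulVec_add, Matrix.mulVec_mulVec, hA, Matrix.zero_mulVec,
    add_zero]
  exact hz _ (mem_inflation.mpr ⟨0, Submodule.zero_mem _, u, hu', by simp⟩)

end Annihilator

/-- The cycle equation says that X intertwines A and Dᵀ. It gives the value of D at zX in terms of A
and X alone. -/
theorem mulVec_vecMul_eq_vecMul_vecMul {M : ℕ} {A D X : Matrix (Fin M) (Fin M) (ZMod 2)}
    (hX : A * X + X * D.transpose = 0) (z : Fin M → ZMod 2) :
    D.mulVec (Matrix.vecMul z X) = Matrix.vecMul (Matrix.vecMul z A) X := by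
  have h : X * D.transpose = A * X := by
    rw [eq_comm, ← sub_eq_zero, ZModModule.sub_eq_add]; exact hX
  rw [← Matrix.vecMul_transpose, Matrix.vecMul_vecMul, h, Matrix.vecMul_vecMul]

/-- A cycle of the product complex supported on few rows and few columns is a boundary. -/
theorem exists_eq_of_cross_supported {M a : ℕ} {A D X : Matrix (Fin M) (Fin M) (ZMod 2)}
    (hA : A * A = 0) (hA1 : SpreadsLowWeight a A) (hD1 : SpreadsLowWeight a D)
    (hX : A * X + X * D.transpose = 0) {R C : Finset (Fin M)} (hR : R.card ≤ a) (hC : C.card ≤ a)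
    (hsupp : ∀ i ∉ R, ∀ j ∉ C, X i j = 0) :
    ∃ Y, X = A * Y + Y * D.transpose := by
  have hvec : ∀ z : Fin M → ZMod 2, (∀ u ∈ inflation A R, z ⬝ᵥ u = 0) →
      Matrix.vecMul z X ∈ supportedVectors C := by
    intro z hz j hj
    change ∑ i, z i * X i j = 0
    refine Finset.sum_eq_zero fun i _ => ?_
    by_cases hi : i ∈ R
    · rw [eq_zero_of_annihilates_inflation hz hi, zero_mul]
    · rw [hsupp i hi j hj, mul_zero]
  -- By double orthogonality it suffices that zX = 0 for each annihilating z. Both zX and its image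
  -- (zA)X under D are supported on C, so the spreading property of D forces this.
  have hcol : ∀ j, (fun i => X i j) ∈ inflation A R := by
    intro j
    refine mem_of_forall_dotProduct_eq_zero _ _ fun z hz => ?_
    have h0 : Matrix.vecMul z X = 0 := by
      by_contra hne
      have h1 := hD1 _ hne
        ((hammingNorm_le_card_of_mem_supportedVectors (hvec z hz)).trans hC)
      rw [mulVec_vecMul_eq_vecMul_vecMul hX] at h1
      have h2 := hammingNorm_le_card_of_mem_supportedVectors
        (hvec _ (vecMul_annihilates_inflation hA hz))
      omega
    exact congrFun h0 j
  choose u hu w hw huw using fun j => mem_inflation.mp (hcol j)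
  let Y₁ : Matrix (Fin M) (Fin M) (ZMod 2) := Matrix.of fun i j => u j i
  let Y₂ : Matrix (Fin M) (Fin M) (ZMod 2) := Matrix.of fun i j => w j i
  have hXY : X = Y₁ + A * Y₂ := by
    ext i j
    exact (congrFun (huw j) i).symm
  have hY₁ : ∀ i ∉ R, ∀ j, Y₁ i j = 0 := fun i hi j => hu j i hi
  have hY₂ : ∀ i ∉ R, ∀ j, Y₂ i j = 0 := fun i hi j => hw j i hi
  have hrows : ∀ Y : Matrix (Fin M) (Fin M) (ZMod 2), (∀ i ∉ R, ∀ j, Y i j = 0) →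
      ∀ i ∉ R, ∀ j, (Y * D.transpose) i j = 0 := by
    intro Y hY i hi j
    rw [Matrix.mul_apply]
    exact Finset.sum_eq_zero fun k _ => by rw [hY i hi k, zero_mul]
  -- The cycle equation for X = Y₁ + A Y₂, with A² = 0. Both `Y₁` and `Y₂` have rows only in R, so
  -- each column of Y₁ + Y₂Dᵀ and its image under A is supported on R; the spreading property of A
  -- makes the column zero.
  have hE : A * (Y₁ + Y₂ * D.transpose) = Y₁ * D.transpose := by
    have h1 : A * X = A * Y₁ := by
      rw [hXY, Matrix.mul_add, ← Matrix.mul_assoc, hA, Matrix.zero_mul, add_zero]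
    have h2 : A * Y₁ + (Y₁ + A * Y₂) * D.transpose = 0 := by rw [← h1, ← hXY]; exact hX
    rw [← sub_eq_zero (a := A * (Y₁ + Y₂ * D.transpose)), ZModModule.sub_eq_add, ← h2,
      Matrix.mul_add, Matrix.add_mul, Matrix.mul_assoc]
    abel
  have hzero : Y₁ + Y₂ * D.transpose = 0 := by
    ext i j
    by_contra hne
    have hcol : (fun k => (Y₁ + Y₂ * D.transpose) k j) ∈ supportedVectors R := by
      intro k hk
      change Y₁ k j + (Y₂ * D.transpose) k j = 0
      rw [ hY₁ k hk, hrows _ hY₂ k hk, add_zero]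
    have h1 := hA1 (fun k => (Y₁ + Y₂ * D.transpose) k j) (fun h => hne (congrFun h i))
      ((hammingNorm_le_card_of_mem_supportedVectors hcol).trans hR)
    have h2 : A.mulVec (fun k => (Y₁ + Y₂ * D.transpose) k j) =
        fun k => (Y₁ * D.transpose) k j := by
      rw [← hE]; rfl
    rw [h2] at h1
    have h3 := hammingNorm_le_card_of_mem_supportedVectors
      (show (fun k => (Y₁ * D.transpose) k j) ∈ supportedVectors R from
        fun k hk => hrows _ hY₁ k hk j)
    omega
  refine ⟨Y₂, ?_⟩
  have : Y₁ = Y₂ * D.transpose := by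
    rw [← sub_eq_zero, ZModModule.sub_eq_add]; exact hzero
  rw [hXY, this, add_comm]

/-- No `⌈r/2⌉` linearly independent low weight vectors are mapped, up to low weight vectors, into a
space spanned by `r` low weight vectors, for `4 * r ≤ N`. -/
def AvoidsLowWeightSpans {M : ℕ} (a N : ℕ) (A : Matrix (Fin M) (Fin M) (ZMod 2)) : Prop :=
  ∀ r, 1 ≤ r → 4 * r ≤ N → ∀ P : Fin r → Fin M → ZMod 2, (∀ j, hammingNorm (P j) ≤ a) →
    ∀ g : Fin ((r + 1) / 2) → Fin M → ZMod 2, LinearIndependent (ZMod 2) g →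
      (∀ i, hammingNorm (g i) ≤ a) →
      ¬ ∀ i, ∃ (c : Fin r → ZMod 2) (f : Fin M → ZMod 2), hammingNorm f ≤ a ∧
        A.mulVec (g i) = ∑ j, c j • P j + f

/-- The vectors `z` annihilate `F^R + A F^R` and the vectors `z X` are linearly independent. -/
def Detects {M q : ℕ} (A : Matrix (Fin M) (Fin M) (ZMod 2)) (R : Finset (Fin M))
    (X : Matrix (Fin M) (Fin M) (ZMod 2)) (z : Fin q → Fin M → ZMod 2) : Prop :=
  (∀ i, ∀ u ∈ inflation A R, z i ⬝ᵥ u = 0) ∧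
    LinearIndependent (ZMod 2) fun i => Matrix.vecMul (z i) X

/-- Elements p = u + A g of the intersection have independent g whenever the p are independent: a
relation among the g puts the same combination of the p into F^R, which meets the column space of X
trivially because X vanishes on R. -/
theorem exists_linearIndependent_preimages {M d : ℕ} {A X : Matrix (Fin M) (Fin M) (ZMod 2)}
    {R : Finset (Fin M)} (hX : ∀ i ∈ R, ∀ j, X i j = 0)
    (hd : d ≤ Module.finrank (ZMod 2) ↥(LinearMap.range X.mulVecLin ⊓ inflation A R)) :
    ∃ g : Fin d → Fin M → ZMod 2, LinearIndependent (ZMod 2) g ∧ (∀ i, g i ∈ supportedVectors R) ∧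
      ∀ i, ∃ p ∈ LinearMap.range X.mulVecLin, ∃ u ∈ supportedVectors R,
        A.mulVec (g i) = p + u := by
  obtain ⟨p, hp⟩ := exists_linearIndependent_of_le_finrank hd
  have hp' : LinearIndependent (ZMod 2) fun i => (p i).1 :=
    hp.map' (Submodule.subtype _) (Submodule.ker_subtype _)
  choose u hu g hg hug using fun i => mem_inflation.mp (p i).2.2
  have hdisj : ∀ v ∈ LinearMap.range X.mulVecLin, v ∈ supportedVectors R → v = 0 := by
    rintro _ ⟨w, rfl⟩ hv
    ext i
    by_cases hi : i ∈ R
    · change ∑ j, X i j * w j = 0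
      exact Finset.sum_eq_zero fun j _ => by rw [hX i hi j, zero_mul]
    · exact hv i hi
  refine ⟨g, ?_, hg, fun i => ⟨(p i).1, (p i).2.1, u i, hu i, ?_⟩⟩
  · rw [Fintype.linearIndependent_iff] at hp' ⊢
    intro c hc
    refine hp' c (hdisj _ (Submodule.sum_mem _ fun i _ => Submodule.smul_mem _ _ (p i).2.1) ?_)
    have : ∑ i, c i • (p i).1 = ∑ i, c i • u i + A.mulVec (∑ i, c i • g i) := by
      rw [Matrix.mulVec_sum, ← Finset.sum_add_distrib]
      refine Finset.sum_congr rfl fun i _ => ?_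
      rw [← hug i, smul_add, Matrix.mulVec_smul]
    rw [this, hc, Matrix.mulVec_zero, add_zero]
    exact Submodule.sum_mem _ fun i _ => Submodule.smul_mem _ _ (hu i)
  · rw [← hug i, add_comm (u i), add_assoc, ZModModule.add_self, add_zero]

/-- The intersection has dimension at most ⌊r/2⌋. For 4r ≤ N a larger one contradicts the avoidance
property, applied to r columns spanning the column space. For larger r the preimages lie in F^R, so
the dimension is at most a, and r > 6a. -/
theorem finrank_inf_inflation_le {M a N : ℕ} {A X : Matrix (Fin M) (Fin M) (ZMod 2)}
    (haN : 24 * a ≤ N) (hA2 : AvoidsLowWeightSpans a N A) {R : Finset (Fin M)} (hR : R.card ≤ a)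
    (hX : ∀ i ∈ R, ∀ j, X i j = 0) (hcol : ∀ j, hammingNorm (fun i => X i j) ≤ a)
    (hr : 1 ≤ X.rank) :
    Module.finrank (ZMod 2) ↥(LinearMap.range X.mulVecLin ⊓ inflation A R) + (X.rank + 1) / 2 ≤
      X.rank := by
  rcases le_or_gt (4 * X.rank) N with hsmall | hlarge
  · suffices h : ¬ (X.rank + 1) / 2 ≤
        Module.finrank (ZMod 2) ↥(LinearMap.range X.mulVecLin ⊓ inflation A R) by omega
    intro h
    obtain ⟨g, hg, hgR, hAg⟩ := exists_linearIndependent_preimages hX h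
    obtain ⟨P, hP, hPspan⟩ : ∃ P : Fin X.rank → Fin M → ZMod 2,
        (∀ i, P i ∈ Set.range X.col) ∧
          Submodule.span (ZMod 2) (Set.range P) = LinearMap.range X.mulVecLin := by
      rw [Matrix.rank, Matrix.range_mulVecLin]
      obtain ⟨P, hP, hPspan, -⟩ := Submodule.exists_fun_fin_finrank_span_eq (ZMod 2)
        (Set.range X.col)
      exact ⟨P, hP, hPspan⟩
    refine hA2 X.rank hr hsmall P (fun j => ?_) g hg
      (fun i => (hammingNorm_le_card_of_mem_supportedVectors (hgR i)).trans hR) fun i => ?_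
    · obtain ⟨k, hk⟩ := hP j
      rw [← hk]; exact hcol k
    · obtain ⟨p, hp, u, hu, h⟩ := hAg i
      rw [← hPspan, Submodule.mem_span_range_iff_exists_fun] at hp
      obtain ⟨c, rfl⟩ := hp
      exact ⟨c, u, (hammingNorm_le_card_of_mem_supportedVectors hu).trans hR, h⟩
  · obtain ⟨g, hg, hgR, -⟩ := exists_linearIndependent_preimages (A := A) hX le_rfl
    have h1 : LinearIndependent (ZMod 2) fun i => (⟨g i, hgR i⟩ : supportedVectors R) :=
      LinearIndependent.of_comp (Submodule.subtype _) hg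
    have h2 := h1.fintype_card_le_finrank
    rw [Fintype.card_fin] at h2
    have h3 := finrank_supportedVectors_le R
    omega

/-- Vectors annihilating the inflation `K` are functionals on the quotient by `K`. The composite of
X with the quotient map has rank at least ⌈r/2⌉ by the dimension bound, hence so does its dual map,
and independent elements in the range of that dual are the vectors zX. -/
theorem exists_detects {M a N : ℕ} {A X : Matrix (Fin M) (Fin M) (ZMod 2)}
    (haN : 24 * a ≤ N) (hA2 : AvoidsLowWeightSpans a N A) {R : Finset (Fin M)} (hR : R.card ≤ a)
    (hX : ∀ i ∈ R, ∀ j, X i j = 0) (hcol : ∀ j, hammingNorm (fun i => X i j) ≤ a)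
    (hr : 1 ≤ X.rank) :
    ∃ z : Fin ((X.rank + 1) / 2) → Fin M → ZMod 2, Detects A R X z := by
  have hdim := finrank_inf_inflation_le haN hA2 hR hX hcol hr
  set K := inflation A R with hK
  let f := K.mkQ ∘ₗ X.mulVecLin
  have h1 : (X.rank + 1) / 2 ≤ Module.finrank (ZMod 2) (LinearMap.range f.dualMap) := by
    rw [LinearMap.finrank_range_dualMap_eq_finrank_range, LinearMap.range_comp]
    have h2 := LinearMap.finrank_range_add_finrank_ker
      (K.mkQ.domRestrict (LinearMap.range X.mulVecLin))
    rw [LinearMap.range_domRestrict] at h2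
    have h3 : Module.finrank (ZMod 2)
        (LinearMap.ker (K.mkQ.domRestrict (LinearMap.range X.mulVecLin))) ≤
        Module.finrank (ZMod 2) ↥(LinearMap.range X.mulVecLin ⊓ K) := by
      let θ : LinearMap.ker (K.mkQ.domRestrict (LinearMap.range X.mulVecLin)) →ₗ[ZMod 2]
          ↥(LinearMap.range X.mulVecLin ⊓ K) :=
        { toFun := fun x => ⟨x.1.1, x.1.2, (Submodule.Quotient.mk_eq_zero K).mp x.2⟩
          map_add' := fun _ _ => rfl
          map_smul' := fun _ _ => rfl }
      refine LinearMap.finrank_le_finrank_of_injective (f := θ) fun x y h => ?_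
      exact Subtype.ext (Subtype.ext (congrArg (fun v => v.1) h))
    have h4 : Module.finrank (ZMod 2) (LinearMap.range X.mulVecLin) = X.rank := rfl
    omega
  obtain ⟨φ, hφ⟩ := exists_linearIndependent_of_le_finrank h1
  choose ℓ hℓ using fun i => LinearMap.mem_range.mp (φ i).2
  have hφ' : LinearIndependent (ZMod 2) fun i => (φ i).1 :=
    hφ.map' (Submodule.subtype _) (Submodule.ker_subtype _)
  have hdot : ∀ i v, (fun j => ℓ i (K.mkQ (Pi.single j 1))) ⬝ᵥ v = ℓ i (K.mkQ v) := by
    intro i v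
    conv_rhs => rw [pi_eq_sum_univ' v, map_sum, map_sum]
    refine Finset.sum_congr rfl fun i _ => ?_
    rw [map_smul, map_smul, smul_eq_mul, mul_comm]
  refine ⟨fun i j => ℓ i (K.mkQ (Pi.single j 1)), fun i u hu => ?_, ?_⟩
  · rw [hdot, show K.mkQ u = 0 from (Submodule.Quotient.mk_eq_zero K).mpr hu, map_zero]
  · rw [Fintype.linearIndependent_iff] at hφ' ⊢
    intro c hc
    refine hφ' c (LinearMap.ext fun v => ?_)
    have h2 := congrArg (· ⬝ᵥ v) hc
    simp only [sum_dotProduct, smul_dotProduct, zero_dotProduct, ← Matrix.dotProduct_mulVec,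
      hdot] at h2
    rw [LinearMap.sum_apply, LinearMap.zero_apply, ← h2]
    refine Finset.sum_congr rfl fun i _ => ?_
    rw [LinearMap.smul_apply, ← hℓ i]
    rfl

/-- The event to be excluded by the union bound over low-rank matrices with sparse rows and
columns. -/
def HasSparseIntertwiner {M : ℕ} (a : ℕ) (A D : Matrix (Fin M) (Fin M) (ZMod 2)) : Prop :=
  ∃ (R : Finset (Fin M)) (X : Matrix (Fin M) (Fin M) (ZMod 2)), R.card ≤ a ∧ 1 ≤ X.rank ∧
    (∀ i, hammingNorm (X i) ≤ a) ∧ (∀ j, hammingNorm (fun i => X i j) ≤ a) ∧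
    (∃ z : Fin ((X.rank + 1) / 2) → Fin M → ZMod 2, Detects A R X z) ∧
    ∀ z : Fin ((X.rank + 1) / 2) → Fin M → ZMod 2, Detects A R X z →
      ∃ γ f : Fin ((X.rank + 1) / 2) → Fin M → ZMod 2,
        (∀ i, hammingNorm (γ i) ≤ a) ∧ (∀ i, hammingNorm (f i) ≤ a) ∧
        LinearIndependent (ZMod 2) (fun i => Matrix.vecMul (z i) X + γ i) ∧
        ∀ i, D.mulVec (Matrix.vecMul (z i) X + γ i) =
          Matrix.vecMul (Matrix.vecMul (z i) A) X + f i

/-- Otherwise a + 1 indices would each carry weight at least a + 1. -/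
theorem card_heavy_le {M a : ℕ} (w : Fin M → ℕ) (hw : ∑ i, w i < (a + 1) ^ 2) :
    (Finset.univ.filter fun i => a < w i).card ≤ a := by
  by_contra! h
  have h1 : (Finset.univ.filter fun i => a < w i).card • (a + 1) ≤
      ∑ i ∈ Finset.univ.filter fun i => a < w i, w i :=
    Finset.card_nsmul_le_sum _ _ _ fun i hi => (Finset.mem_filter.mp hi).2
  have h2 : ∑ i ∈ Finset.univ.filter (fun i => a < w i), w i ≤ ∑ i, w i :=
    Finset.sum_le_sum_of_subset (Finset.filter_subset _ _)
  rw [smul_eq_mul] at h1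
  nlinarith

/-- A light cycle of the product complex that is not a boundary yields a sparse intertwiner. -/
theorem hasSparseIntertwiner_of_light_cycle {M a N : ℕ}
    {A D X : Matrix (Fin M) (Fin M) (ZMod 2)} (hA : A * A = 0) (haN : 24 * a ≤ N)
    (hA1 : SpreadsLowWeight a A) (hD1 : SpreadsLowWeight a D) (hA2 : AvoidsLowWeightSpans a N A)
    (hX : A * X + X * D.transpose = 0) (hXtriv : ¬ ∃ Y, X = A * Y + Y * D.transpose)
    (hrow : ∑ i, hammingNorm (X i) < (a + 1) ^ 2)
    (hcol : ∑ j, hammingNorm (fun i => X i j) < (a + 1) ^ 2) :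
    HasSparseIntertwiner a A D := by
  set R := Finset.univ.filter fun i => a < hammingNorm (X i) with hRdef
  set C := Finset.univ.filter fun j => a < hammingNorm (fun i => X i j) with hCdef
  have hR : R.card ≤ a := card_heavy_le _ hrow
  have hC : C.card ≤ a := card_heavy_le _ hcol
  let T : Matrix (Fin M) (Fin M) (ZMod 2) :=
    Matrix.of fun i j => if i ∈ R ∨ j ∈ C then 0 else X i j
  have hT : ∀ i j, T i j = if i ∈ R ∨ j ∈ C then 0 else X i j := fun _ _ => rfl
  have hTR : ∀ i ∈ R, ∀ j, T i j = 0 := fun i hi j => by rw [hT, if_pos (Or.inl hi)]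
  have hTC : ∀ j ∈ C, ∀ i, T i j = 0 := fun j hj i => by rw [hT, if_pos (Or.inr hj)]
  have hTX : ∀ i ∉ R, ∀ j ∉ C, T i j = X i j := fun i hi j hj => by
    rw [hT, if_neg (by tauto)]
  have hle : ∀ i j, T i j ≠ 0 → X i j ≠ 0 := by
    intro i j h
    rw [hT] at h
    split_ifs at h with h'
    · exact absurd rfl h
    · exact h
  have hTrow : ∀ i, hammingNorm (T i) ≤ a := by
    intro i
    by_cases hi : i ∈ R
    · have : T i = 0 := funext fun j => hTR i hi j
      rw [this, hammingNorm_zero]; omega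
    · refine le_trans (Finset.card_le_card fun j hj => ?_) (not_lt.mp fun h => hi (by
        rw [hRdef]; exact Finset.mem_filter.mpr ⟨Finset.mem_univ _, h⟩))
      exact Finset.mem_filter.mpr ⟨Finset.mem_univ _, hle i j (Finset.mem_filter.mp hj).2⟩
  have hTcol : ∀ j, hammingNorm (fun i => T i j) ≤ a := by
    intro j
    by_cases hj : j ∈ C
    · have : (fun i => T i j) = 0 := funext fun i => hTC j hj i
      rw [this, hammingNorm_zero]; omega
    · refine le_trans (Finset.card_le_card fun i hi => ?_) (not_lt.mp fun h => hj (by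
        rw [hCdef]; exact Finset.mem_filter.mpr ⟨Finset.mem_univ _, h⟩))
      exact Finset.mem_filter.mpr ⟨Finset.mem_univ _, hle i j (Finset.mem_filter.mp hi).2⟩
  have hrank : 1 ≤ T.rank := by
    by_contra! h
    have h0 : T = 0 := by
      rw [Nat.lt_one_iff, Matrix.rank, Submodule.finrank_eq_zero, LinearMap.range_eq_bot] at h
      ext i j
      simpa using congrFun (LinearMap.congr_fun h (Pi.single j 1)) i
    -- T = 0 means that X is supported on the cross formed by R and C, where every cycle is a
    -- boundary.
    refine hXtriv (exists_eq_of_cross_supported hA hA1 hD1 hX hR hC fun i hi j hj => ?_)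
    rw [← hTX i hi j hj, h0]; rfl
  refine ⟨R, T, hR, hrank, hTrow, hTcol, exists_detects haN hA2 hR hTR hTcol hrank, ?_⟩
  intro z hz
  have hdiff : ∀ v : Fin M → ZMod 2, (∀ u ∈ inflation A R, v ⬝ᵥ u = 0) →
      Matrix.vecMul v X - Matrix.vecMul v T ∈ supportedVectors C := by
    intro v hv j hj
    rw [Pi.sub_apply, sub_eq_zero]
    change ∑ i, v i * X i j = ∑ i, v i * T i j
    refine Finset.sum_congr rfl fun i _ => ?_
    by_cases hi : i ∈ R
    · rw [eq_zero_of_annihilates_inflation hv hi, zero_mul, zero_mul]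
    · rw [hTX i hi j hj]
  have hz' : ∀ i, ∀ u ∈ inflation A R, Matrix.vecMul (z i) A ⬝ᵥ u = 0 :=
    fun i => vecMul_annihilates_inflation hA (hz.1 i)
  -- The errors are the discrepancies between X and T, seen through z and through zA. They live on C
  -- and are therefore light.
  refine ⟨fun i => Matrix.vecMul (z i) X - Matrix.vecMul (z i) T,
    fun i => Matrix.vecMul (Matrix.vecMul (z i) A) X - Matrix.vecMul (Matrix.vecMul (z i) A) T,
    fun i => (hammingNorm_le_card_of_mem_supportedVectors (hdiff _ (hz.1 i))).trans hC,
    fun i => (hammingNorm_le_card_of_mem_supportedVectors (hdiff _ (hz' i))).trans hC, ?_, ?_⟩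
  -- The errors do not spoil independence: off C they vanish, and on C the vectors zT vanish, so a
  -- relation among the perturbed vectors restricts to one among the zT.
  · have h1 := hz.2
    rw [Fintype.linearIndependent_iff] at h1 ⊢
    intro c hc
    refine h1 c (funext fun j => ?_)
    rw [Finset.sum_apply]
    by_cases hj : j ∈ C
    · refine Finset.sum_eq_zero fun i _ => ?_
      have : Matrix.vecMul (z i) T j = 0 := by
        change ∑ k, z i k * T k j = 0
        exact Finset.sum_eq_zero fun k _ => by rw [hTC j hj k, mul_zero]
      rw [Pi.smul_apply, this, smul_zero]
    · have h2 := congrFun hc j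
      rw [Finset.sum_apply] at h2
      rw [← h2]
      refine Finset.sum_congr rfl fun i _ => ?_
      have h3 := hdiff _ (hz.1 i) j hj
      rw [Pi.smul_apply, Pi.smul_apply, Pi.add_apply]
      beta_reduce
      rw [h3, add_zero]
  · intro i
    rw [add_sub_cancel, add_sub_cancel, mulVec_vecMul_eq_vecMul_vecMul hX]

/-! ### Union bounds over light vectors and sparse matrices -/

/-- The binary vectors of length `M` and weight at most `a`. -/
abbrev LightVector (M a : ℕ) : Type := {v : Fin M → ZMod 2 // hammingNorm v ≤ a}

/-- The union bound in integer form: S is the size of the ensemble, 1/p bounds the probability of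
each event, and W indexes the witnesses. -/
theorem ncard_mul_le_of_forall_exists {α W : Type*} [Finite α] [Finite W] {s : Set α}
    {E : W → Set α} {p S : ℕ} (hs : ∀ x ∈ s, ∃ w, x ∈ E w) (hE : ∀ w, (E w).ncard * p ≤ S) :
    s.ncard * p ≤ Nat.card W * S := by
  classical
  have := Fintype.ofFinite W
  have h1 : s ⊆ ⋃ w ∈ (Finset.univ : Finset W), E w := by
    intro x hx
    obtain ⟨w, hw⟩ := hs x hx
    simp only [Set.mem_iUnion]
    exact ⟨w, Finset.mem_univ w, hw⟩
  calc s.ncard * p ≤ (∑ w, (E w).ncard) * p :=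
        Nat.mul_le_mul_right _ ((Set.ncard_le_ncard h1 (Set.toFinite _)).trans
          (Finset.set_ncard_biUnion_le _ _))
    _ = ∑ w, (E w).ncard * p := Finset.sum_mul _ _ _
    _ ≤ ∑ _w : W, S := Finset.sum_le_sum fun w _ => hE w
    _ = Nat.card W * S := by simp

/-- Bookkeeping of exponents: p from the probability, q from the number of witnesses, e what
remains. -/
theorem mul_two_pow_le_of_le {x S c p q e : ℕ} (h : x * 2 ^ p ≤ c * S) (hc : c ≤ 2 ^ q)
    (he : q + e ≤ p) : x * 2 ^ e ≤ S := by
  refine Nat.le_of_mul_le_mul_left ?_ (pow_pos (zero_lt_two' ℕ) q)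
  calc 2 ^ q * (x * 2 ^ e) = x * 2 ^ (q + e) := by rw [pow_add]; ring
    _ ≤ x * 2 ^ p := Nat.mul_le_mul_left _ (Nat.pow_le_pow_right (by norm_num) he)
    _ ≤ c * S := h
    _ ≤ 2 ^ q * S := Nat.mul_le_mul_right _ hc

/-- A violation is witnessed by two light vectors, the source and its image: 2b bits against a
probability 2^(-24b). -/
theorem ncard_not_spreadsLowWeight_le {M L a b : ℕ} (hb : Nat.card (LightVector M a) ≤ 2 ^ b)
    (hN : 3 * (24 * b) + 2 ≤ L) (hLM : L ≤ M) :
    {A ∈ squareZeroMatrices M L | ¬ SpreadsLowWeight a A}.ncard * 2 ^ (12 * b) ≤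
      (squareZeroMatrices M L).ncard := by
  have key := ncard_mul_le_of_forall_exists (p := 2 ^ (24 * b * 1))
    (S := (squareZeroMatrices M L).ncard)
    (s := {A ∈ squareZeroMatrices M L | ¬ SpreadsLowWeight a A})
    (W := LightVector M a × LightVector M a)
    (E := fun w => {A ∈ squareZeroMatrices M L | w.1.1 ≠ 0 ∧ A.mulVec w.1.1 = w.2.1}) ?_ ?_
  · refine mul_two_pow_le_of_le key (q := b + b) ?_ (by omega)
    rw [Nat.card_prod, pow_add]
    exact Nat.mul_le_mul hb hb
  · rintro A ⟨hA, h⟩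
    rw [SpreadsLowWeight] at h
    push Not at h
    obtain ⟨g, hg0, hg, hAg⟩ := h
    exact ⟨(⟨g, hg⟩, ⟨_, hAg⟩), hA, hg0, rfl⟩
  · rintro ⟨g, y⟩
    by_cases hg : g.1 = 0
    · simp [hg]
    · refine le_trans (Nat.mul_le_mul_right _ (Set.ncard_le_ncard ?_))
        (card_prescribed_mul_le hN hLM (fun _ : Fin 1 => g.1) (fun _ => y.1)
          (LinearIndependent.of_subsingleton 0 hg))
      rintro A ⟨hA, -, h⟩
      exact ⟨hA, fun _ => h⟩

/-- For fixed r and d = ⌈r/2⌉ the witnesses are r vectors P, d pairs (g, f) and rd coefficients. As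
r ≤ 6b, they cost br + (2b + r)d ≤ 10bd bits against 24bd. This leaves at least 13b, of which b pays
for the sum over r. -/
theorem ncard_not_avoidsLowWeightSpans_le {M L a b : ℕ}
    (hb : Nat.card (LightVector M a) ≤ 2 ^ b) (hM : M ≤ 2 ^ b)
    (hN : 3 * (24 * b) + 2 ≤ L) (hLM : L ≤ M) :
    {A ∈ squareZeroMatrices M L | ¬ AvoidsLowWeightSpans a (24 * b) A}.ncard * 2 ^ (12 * b) ≤
      (squareZeroMatrices M L).ncard := by
  let E : Fin M → Set (Matrix (Fin M) (Fin M) (ZMod 2)) := fun k =>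
    {A ∈ squareZeroMatrices M L | 4 * (k.1 + 1) ≤ 24 * b ∧
      ∃ P : Fin (k.1 + 1) → Fin M → ZMod 2, (∀ j, hammingNorm (P j) ≤ a) ∧
      ∃ g : Fin ((k.1 + 1 + 1) / 2) → Fin M → ZMod 2, LinearIndependent (ZMod 2) g ∧
      (∀ i, hammingNorm (g i) ≤ a) ∧
      ∀ i, ∃ (c : Fin (k.1 + 1) → ZMod 2) (f : Fin M → ZMod 2), hammingNorm f ≤ a ∧
        A.mulVec (g i) = ∑ j, c j • P j + f}
  have key := ncard_mul_le_of_forall_exists (p := 2 ^ (13 * b))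
    (S := (squareZeroMatrices M L).ncard)
    (s := {A ∈ squareZeroMatrices M L | ¬ AvoidsLowWeightSpans a (24 * b) A}) (E := E) ?_ ?_
  · exact mul_two_pow_le_of_le key (q := b) (by simpa using hM) (by omega)
  · rintro A ⟨hA, h⟩
    rw [AvoidsLowWeightSpans] at h
    push Not at h
    obtain ⟨r, hr1, hr, P, hP, g, hg, hga, h⟩ := h
    obtain ⟨k, rfl⟩ : ∃ k, r = k + 1 := ⟨r - 1, by omega⟩
    exact ⟨⟨k, by omega⟩, hA, hr, P, hP, g, hg, hga, h⟩
  · intro k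
    set r := k.1 + 1 with hr
    set d := (r + 1) / 2 with hd
    by_cases hrb : 4 * r ≤ 24 * b
    swap
    · have : E k = ∅ := Set.eq_empty_of_forall_notMem fun A hA => hrb hA.2.1
      rw [this]; simp
    have key := ncard_mul_le_of_forall_exists (p := 2 ^ (24 * b * d))
      (S := (squareZeroMatrices M L).ncard) (s := E k)
      (W := (Fin r → LightVector M a) ×
        (Fin d → LightVector M a × LightVector M a × (Fin r → ZMod 2)))
      (E := fun w => {A ∈ squareZeroMatrices M L |
        LinearIndependent (ZMod 2) (fun i => (w.2 i).1.1) ∧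
        ∀ i, A.mulVec (w.2 i).1.1 = ∑ j, (w.2 i).2.2 j • (w.1 j).1 + (w.2 i).2.1.1}) ?_ ?_
    · refine mul_two_pow_le_of_le key (q := b * r + (b + (b + r)) * d) ?_ ?_
      · simp only [Nat.card_prod, Nat.card_fun, Nat.card_eq_fintype_card (α := Fin _),
          Fintype.card_fin, Nat.card_zmod, pow_add, pow_mul]
        gcongr
      · have h1 : b * r ≤ b * (2 * d) := Nat.mul_le_mul_left _ (by omega)
        have h2 : r * d ≤ 6 * b * d := Nat.mul_le_mul_right _ (by omega)
        have h3 : b * 1 ≤ b * d := Nat.mul_le_mul_left _ (by omega)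
        nlinarith
    · rintro A ⟨hA, -, P, hP, g, hg, hga, h⟩
      choose c f hf hAg using h
      exact ⟨(fun j => ⟨P j, hP j⟩, fun i => (⟨g i, hga i⟩, ⟨f i, hf i⟩, c i)), hA, hg, hAg⟩
    · intro w
      by_cases hg : LinearIndependent (ZMod 2) (fun i => (w.2 i).1.1)
      · refine le_trans (Nat.mul_le_mul_right _ (Set.ncard_le_ncard ?_))
          (card_prescribed_mul_le hN hLM _
            (fun i => ∑ j, (w.2 i).2.2 j • (w.1 j).1 + (w.2 i).2.1.1) hg)
        rintro A ⟨hA, -, h⟩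
        exact ⟨hA, h⟩
      · simp [hg]

theorem card_light_finset_le (M a : ℕ) :
    Nat.card {R : Finset (Fin M) // R.card ≤ a} ≤ Nat.card (LightVector M a) := by
  refine Nat.card_le_card_of_injective
    (fun R => ⟨fun i => if i ∈ R.1 then 1 else 0, le_trans (le_of_eq ?_) R.2⟩) ?_
  · simp [hammingNorm]
  · intro R R' h
    ext i
    have := congrFun (congrArg Subtype.val h) i
    by_cases h1 : i ∈ R.1 <;> by_cases h2 : i ∈ R'.1 <;> simp_all

theorem Matrix.exists_columns_span {M : ℕ} (X : Matrix (Fin M) (Fin M) (ZMod 2)) :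
    ∃ J : Fin X.rank → Fin M,
      Submodule.span (ZMod 2) (Set.range fun k => X.col (J k)) = LinearMap.range X.mulVecLin := by
  rw [Matrix.rank, Matrix.range_mulVecLin]
  obtain ⟨P, hP, hPspan, -⟩ := Submodule.exists_fun_fin_finrank_span_eq (ZMod 2)
    (Set.range X.col)
  choose J hJ using hP
  exact ⟨J, by rwa [show (fun k => X.col (J k)) = P from funext hJ]⟩

/-- A matrix of rank `r` is determined by `r` rows spanning its row space and `r` columns spanning
its column space. -/
theorem Matrix.eq_of_rows_eq_of_columns_eq {M r : ℕ} {X X' : Matrix (Fin M) (Fin M) (ZMod 2)}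
    {I J : Fin r → Fin M}
    (hJ : Submodule.span (ZMod 2) (Set.range fun k => X.col (J k)) = LinearMap.range X.mulVecLin)
    (hJ' : Submodule.span (ZMod 2) (Set.range fun k => X'.col (J k)) =
      LinearMap.range X'.mulVecLin)
    (hI : Submodule.span (ZMod 2) (Set.range fun k => X.transpose.col (I k)) =
      LinearMap.range X.transpose.mulVecLin)
    (hcol : ∀ k, X.col (J k) = X'.col (J k)) (hrow : ∀ k, X (I k) = X' (I k)) : X = X' := by
  have hmem : ∀ Y : Matrix (Fin M) (Fin M) (ZMod 2), ∀ j,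
      Y.col j ∈ LinearMap.range Y.mulVecLin := fun Y j => by
    rw [Matrix.range_mulVecLin]; exact Submodule.subset_span ⟨j, rfl⟩
  have hcolX : ∀ j, X'.col j ∈ LinearMap.range X.mulVecLin := by
    intro j
    rw [← hJ, show (fun k => X.col (J k)) = fun k => X'.col (J k) from funext hcol, hJ']
    exact hmem X' j
  ext i j
  -- The difference of the j-th columns is Xw for some w. Its entries at the selected rows vanish,
  -- and every row of X is a combination of those, so Xw = 0.
  obtain ⟨w, hw⟩ := Submodule.sub_mem _ (hmem X j) (hcolX j)
  have hi := hmem X.transpose i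
  rw [← hI, Submodule.mem_span_range_iff_exists_fun] at hi
  obtain ⟨s, hs⟩ := hi
  have hw' : ∀ i, X i ⬝ᵥ w = X i j - X' i j := fun i => congrFun hw i
  have hsi : X i = ∑ k, s k • X (I k) := hs.symm
  rw [← sub_eq_zero, ← hw' i, hsi, sum_dotProduct]
  refine Finset.sum_eq_zero fun k _ => ?_
  rw [smul_dotProduct, hw' (I k), hrow k, sub_self, smul_zero]

/-- Encode X by the indices and contents of r rows and r columns spanning its row and column spaces.
Each of these 4r data takes at most b bits. -/
theorem card_sparse_matrices_le {M a b : ℕ} (hb : Nat.card (LightVector M a) ≤ 2 ^ b)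
    (hM : M ≤ 2 ^ b) (r : ℕ) :
    Nat.card {X : Matrix (Fin M) (Fin M) (ZMod 2) // X.rank = r ∧ (∀ i, hammingNorm (X i) ≤ a) ∧
      ∀ j, hammingNorm (fun i => X i j) ≤ a} ≤ 2 ^ (4 * b * r) := by
  have hcols : ∀ X : {X : Matrix (Fin M) (Fin M) (ZMod 2) // X.rank = r ∧
      (∀ i, hammingNorm (X i) ≤ a) ∧ ∀ j, hammingNorm (fun i => X i j) ≤ a},
      ∃ J : Fin r → Fin M, Submodule.span (ZMod 2) (Set.range fun k => X.1.col (J k)) =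
        LinearMap.range X.1.mulVecLin := by
    rintro ⟨X, rfl, -⟩
    exact X.exists_columns_span
  have hrows : ∀ X : {X : Matrix (Fin M) (Fin M) (ZMod 2) // X.rank = r ∧
      (∀ i, hammingNorm (X i) ≤ a) ∧ ∀ j, hammingNorm (fun i => X i j) ≤ a},
      ∃ I : Fin r → Fin M, Submodule.span (ZMod 2)
        (Set.range fun k => X.1.transpose.col (I k)) =
        LinearMap.range X.1.transpose.mulVecLin := by
    rintro ⟨X, rfl, -⟩
    have := X.transpose.exists_columns_span
    rwa [Matrix.rank_transpose] at this
  choose J hJ using hcols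
  choose I hI using hrows
  let enc : {X : Matrix (Fin M) (Fin M) (ZMod 2) // X.rank = r ∧
      (∀ i, hammingNorm (X i) ≤ a) ∧ ∀ j, hammingNorm (fun i => X i j) ≤ a} →
      (Fin r → Fin M) × (Fin r → Fin M) × (Fin r → LightVector M a) × (Fin r → LightVector M a) :=
    fun X => (I X, J X, fun k => ⟨X.1 (I X k), X.2.2.1 _⟩,
      fun k => ⟨fun i => X.1 i (J X k), X.2.2.2 _⟩)
  refine (Nat.card_le_card_of_injective enc fun X X' h => ?_).trans ?_
  · simp only [enc, Prod.mk.injEq] at h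
    obtain ⟨h1, h2, h3, h4⟩ := h
    refine Subtype.ext (Matrix.eq_of_rows_eq_of_columns_eq (hJ X) (h2 ▸ hJ X') (hI X) ?_ ?_)
    · intro k
      have := congrArg Subtype.val (congrFun h4 k)
      rw [← h2] at this
      exact this
    · intro k
      have := congrArg Subtype.val (congrFun h3 k)
      rw [← h1] at this
      exact this
  · have h : 2 ^ (4 * b * r) = (2 ^ b) ^ r * ((2 ^ b) ^ r * ((2 ^ b) ^ r * (2 ^ b) ^ r)) := by
      rw [← pow_mul, ← pow_add, ← pow_add, ← pow_add]; congr 1; ring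
    simp only [Nat.card_prod, Nat.card_fun, Nat.card_eq_fintype_card (α := Fin _),
      Fintype.card_fin, h]
    gcongr

/-- With q = ⌈r/2⌉, the sparse matrix, the set R and the two light errors for each of q vectors cost
4br + b + 2bq ≤ 11bq bits, against 24bq from prescribing D on q independent vectors. The surplus is
at least 13b, and b of it pays for the sum over the rank. -/
theorem ncard_hasSparseIntertwiner_le {M L a b : ℕ}
    (hb : Nat.card (LightVector M a) ≤ 2 ^ b) (hM : M ≤ 2 ^ b)
    (hN : 3 * (24 * b) + 2 ≤ L) (hLM : L ≤ M) (A : Matrix (Fin M) (Fin M) (ZMod 2)) :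
    {D ∈ squareZeroMatrices M L | HasSparseIntertwiner a A D}.ncard * 2 ^ (12 * b) ≤
      (squareZeroMatrices M L).ncard := by
  let E : Fin M → Set (Matrix (Fin M) (Fin M) (ZMod 2)) := fun k =>
    {D ∈ squareZeroMatrices M L | ∃ (R : Finset (Fin M)) (X : Matrix (Fin M) (Fin M) (ZMod 2)),
      R.card ≤ a ∧ X.rank = k.1 + 1 ∧
      (∀ i, hammingNorm (X i) ≤ a) ∧ (∀ j, hammingNorm (fun i => X i j) ≤ a) ∧
      (∃ z : Fin ((k.1 + 1 + 1) / 2) → Fin M → ZMod 2, Detects A R X z) ∧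
      ∀ z : Fin ((k.1 + 1 + 1) / 2) → Fin M → ZMod 2, Detects A R X z →
        ∃ γ f : Fin ((k.1 + 1 + 1) / 2) → Fin M → ZMod 2,
          (∀ i, hammingNorm (γ i) ≤ a) ∧ (∀ i, hammingNorm (f i) ≤ a) ∧
          LinearIndependent (ZMod 2) (fun i => Matrix.vecMul (z i) X + γ i) ∧
          ∀ i, D.mulVec (Matrix.vecMul (z i) X + γ i) =
            Matrix.vecMul (Matrix.vecMul (z i) A) X + f i}
  have key := ncard_mul_le_of_forall_exists (p := 2 ^ (13 * b))
    (S := (squareZeroMatrices M L).ncard)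
    (s := {D ∈ squareZeroMatrices M L | HasSparseIntertwiner a A D}) (E := E) ?_ ?_
  · exact mul_two_pow_le_of_le key (q := b) (by simpa using hM) (by omega)
  · rintro D ⟨hD, R, X, hR, hr1, hrow, hcol, hz, h⟩
    have hr : X.rank ≤ M := X.rank_le_width
    obtain ⟨k, hk⟩ : ∃ k, X.rank = k + 1 := ⟨X.rank - 1, by omega⟩
    rw [hk] at hz h
    exact ⟨⟨k, by omega⟩, hD, R, X, hR, hk, hrow, hcol, hz, h⟩
  · intro k
    set r := k.1 + 1 with hr
    set q := (r + 1) / 2 with hq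
    let Sparse : Type := {X : Matrix (Fin M) (Fin M) (ZMod 2) // X.rank = r ∧
      (∀ i, hammingNorm (X i) ≤ a) ∧ ∀ j, hammingNorm (fun i => X i j) ≤ a}
    -- With A fixed, z is chosen from (R, X) alone, independently of D, so it adds nothing to the
    -- count. This is why the event quantifies over all detecting z. The value 0 is a dummy for
    -- pairs without a detecting family.
    have hchoice : ∀ (R : Finset (Fin M)) (X : Matrix (Fin M) (Fin M) (ZMod 2)),
        ∃ z : Fin q → Fin M → ZMod 2,
          (∃ z' : Fin q → Fin M → ZMod 2, Detects A R X z') → Detects A R X z := by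
      intro R X
      by_cases h : ∃ z' : Fin q → Fin M → ZMod 2, Detects A R X z'
      · exact ⟨h.choose, fun _ => h.choose_spec⟩
      · exact ⟨0, fun h' => absurd h' h⟩
    choose z hz using hchoice
    have key := ncard_mul_le_of_forall_exists (p := 2 ^ (24 * b * q))
      (S := (squareZeroMatrices M L).ncard) (s := E k)
      (W := Sparse × {R : Finset (Fin M) // R.card ≤ a} ×
        (Fin q → LightVector M a × LightVector M a))
      (E := fun w => {D ∈ squareZeroMatrices M L |
        LinearIndependent (ZMod 2)
          (fun i => Matrix.vecMul (z w.2.1.1 w.1.1 i) w.1.1 + (w.2.2 i).1.1) ∧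
        ∀ i, D.mulVec (Matrix.vecMul (z w.2.1.1 w.1.1 i) w.1.1 + (w.2.2 i).1.1) =
          Matrix.vecMul (Matrix.vecMul (z w.2.1.1 w.1.1 i) A) w.1.1 + (w.2.2 i).2.1}) ?_ ?_
    · refine mul_two_pow_le_of_le key (q := 4 * b * r + (b + (b + b) * q)) ?_ ?_
      · have h1 : Nat.card Sparse ≤ 2 ^ (4 * b * r) := card_sparse_matrices_le hb hM r
        have h2 := (card_light_finset_le M a).trans hb
        simp only [Nat.card_prod, Nat.card_fun, Nat.card_eq_fintype_card (α := Fin _),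
          Fintype.card_fin, pow_add, pow_mul _ _ q]
        gcongr
      · have h1 : b * r ≤ b * (2 * q) := Nat.mul_le_mul_left _ (by omega)
        have h3 : b * 1 ≤ b * q := Nat.mul_le_mul_left _ (by omega)
        nlinarith
    · rintro D ⟨hD, R, X, hR, hX, hrow, hcol, hex, h⟩
      obtain ⟨γ, f, hγ, hf, hli, hDz⟩ := h _ (hz R X hex)
      exact ⟨(⟨X, hX, hrow, hcol⟩, ⟨R, hR⟩, fun i => (⟨γ i, hγ i⟩, ⟨f i, hf i⟩)), hD, hli, hDz⟩
    · intro w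
      by_cases hg : LinearIndependent (ZMod 2)
          (fun i => Matrix.vecMul (z w.2.1.1 w.1.1 i) w.1.1 + (w.2.2 i).1.1)
      · refine le_trans (Nat.mul_le_mul_right _ (Set.ncard_le_ncard ?_))
          (card_prescribed_mul_le hN hLM _ (fun i =>
            Matrix.vecMul (Matrix.vecMul (z w.2.1.1 w.1.1 i) A) w.1.1 + (w.2.2 i).2.1) hg)
        rintro D ⟨hD, -, h⟩
        exact ⟨hD, h⟩
      · simp [hg]

/-- The product complex of `A` and `D` has a cycle of weight less than `(a + 1) ^ 2`, regarded as a
matrix, that is not a boundary. -/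
def HasLightCycle {M : ℕ} (a : ℕ) (A D : Matrix (Fin M) (Fin M) (ZMod 2)) : Prop :=
  ∃ X : Matrix (Fin M) (Fin M) (ZMod 2), A * X + X * D.transpose = 0 ∧
    (¬ ∃ Y, X = A * Y + Y * D.transpose) ∧ ∑ i, hammingNorm (X i) < (a + 1) ^ 2

theorem sum_hammingNorm_rows_eq_columns {M : ℕ} (X : Matrix (Fin M) (Fin M) (ZMod 2)) :
    ∑ j, hammingNorm (fun i => X i j) = ∑ i, hammingNorm (X i) := by
  simp only [hammingNorm, Finset.card_filter]
  exact Finset.sum_comm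

/-- Light cycles that are not boundaries are rare. -/
theorem ncard_hasLightCycle_le {M L a b : ℕ} (hab : a ≤ b)
    (hb : Nat.card (LightVector M a) ≤ 2 ^ b) (hM : M ≤ 2 ^ b)
    (hN : 3 * (24 * b) + 2 ≤ L) (hLM : L ≤ M) :
    {p ∈ squareZeroMatrices M L ×ˢ squareZeroMatrices M L |
      HasLightCycle a p.1 p.2}.ncard * 2 ^ (12 * b) ≤
      4 * (squareZeroMatrices M L).ncard ^ 2 := by
  set S := squareZeroMatrices M L with hS
  set B₁ := {A ∈ S | ¬ SpreadsLowWeight a A}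
  set B₂ := {A ∈ S | ¬ AvoidsLowWeightSpans a (24 * b) A}
  set B₃ : Set (Matrix (Fin M) (Fin M) (ZMod 2) × Matrix (Fin M) (Fin M) (ZMod 2)) :=
    {p ∈ S ×ˢ S | HasSparseIntertwiner a p.1 p.2}
  -- Four bad events, each of probability at most 2^(-12b), account for the factor 4.
  have hsub : {p ∈ S ×ˢ S | HasLightCycle a p.1 p.2} ⊆
      (B₁ ×ˢ S ∪ S ×ˢ B₁) ∪ (B₂ ×ˢ S ∪ B₃) := by
    rintro ⟨A, D⟩ ⟨⟨hA, hD⟩, X, hX, hXtriv, hw⟩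
    by_cases h1 : SpreadsLowWeight a A
    swap
    · exact Or.inl (Or.inl ⟨⟨hA, h1⟩, hD⟩)
    by_cases h2 : SpreadsLowWeight a D
    swap
    · exact Or.inl (Or.inr ⟨hA, ⟨hD, h2⟩⟩)
    by_cases h3 : AvoidsLowWeightSpans a (24 * b) A
    swap
    · exact Or.inr (Or.inl ⟨⟨hA, h3⟩, hD⟩)
    exact Or.inr (Or.inr ⟨⟨hA, hD⟩, hasSparseIntertwiner_of_light_cycle hA.1 (by omega) h1 h2 h3 hX
      hXtriv hw (by rwa [sum_hammingNorm_rows_eq_columns])⟩)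
  have h1 := ncard_not_spreadsLowWeight_le hb hN hLM
  have h2 := ncard_not_avoidsLowWeightSpans_le hb hM hN hLM
  have h3 : B₃.ncard * 2 ^ (12 * b) ≤ S.ncard * S.ncard := by
    have := ncard_mul_le_of_forall_exists (W := S) (s := B₃) (p := 2 ^ (12 * b)) (S := S.ncard)
      (E := fun A => {A.1} ×ˢ {D ∈ S | HasSparseIntertwiner a A.1 D}) ?_ ?_
    · rwa [Nat.card_coe_set_eq] at this
    · rintro ⟨A, D⟩ ⟨⟨hA, hD⟩, h⟩
      exact ⟨⟨A, hA⟩, rfl, hD, h⟩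
    · intro A
      rw [Set.ncard_prod, Set.ncard_singleton, one_mul]
      exact ncard_hasSparseIntertwiner_le hb hM hN hLM A.1
  have hle := (Set.ncard_le_ncard hsub (Set.toFinite _)).trans
    ((Set.ncard_union_le _ _).trans (add_le_add (Set.ncard_union_le _ _) (Set.ncard_union_le _ _)))
  simp only [Set.ncard_prod] at hle
  have h1' : B₁.ncard * 2 ^ (12 * b) ≤ S.ncard := h1
  have h2' : B₂.ncard * 2 ^ (12 * b) ≤ S.ncard := h2
  calc _ ≤ (B₁.ncard * S.ncard + S.ncard * B₁.ncard + (B₂.ncard * S.ncard + B₃.ncard)) *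
        2 ^ (12 * b) := Nat.mul_le_mul_right _ hle
    _ = 2 * ((B₁.ncard * 2 ^ (12 * b)) * S.ncard) + (B₂.ncard * 2 ^ (12 * b)) * S.ncard +
        B₃.ncard * 2 ^ (12 * b) := by ring
    _ ≤ 2 * (S.ncard * S.ncard) + S.ncard * S.ncard + S.ncard * S.ncard := by gcongr
    _ = 4 * S.ncard ^ 2 := by ring

/-! ### Homology splittings and the Künneth formula -/

/-- The matrices `s, E, F` exhibit the complex `A` as the direct sum of a contractible complex and
a complex with zero boundary and basis `ι`. -/
structure IsHomologySplitting {Q ι : Type*} [Fintype Q] [DecidableEq Q] [Fintype ι] [DecidableEq ι]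
    (A s : Matrix Q Q (ZMod 2)) (E : Matrix Q ι (ZMod 2)) (F : Matrix ι Q (ZMod 2)) : Prop where
  sq_zero : A * A = 0
  homotopy : A * s + s * A + E * F = 1
  mul_incl : A * E = 0
  proj_mul : F * A = 0
  proj_incl : F * E = 1

/-- The projection F maps ker A onto the space with basis ι, and by the homotopy identity its kernel
there is im A. -/
theorem IsHomologySplitting.two_mul_rank_add_card {Q ι : Type*} [Fintype Q] [DecidableEq Q]
    [Fintype ι] [DecidableEq ι] {A s : Matrix Q Q (ZMod 2)} {E : Matrix Q ι (ZMod 2)}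
    {F : Matrix ι Q (ZMod 2)} (h : IsHomologySplitting A s E F) :
    2 * A.rank + Fintype.card ι = Fintype.card Q := by
  have hrn := LinearMap.finrank_range_add_finrank_ker A.mulVecLin
  rw [Module.finrank_fintype_fun_eq_card] at hrn
  let φ : LinearMap.ker A.mulVecLin →ₗ[ZMod 2] (ι → ZMod 2) :=
    F.mulVecLin ∘ₗ Submodule.subtype _
  have hφ : Function.Surjective φ := by
    intro w
    refine ⟨⟨E.mulVec w, ?_⟩, ?_⟩
    · rw [LinearMap.mem_ker, Matrix.mulVecLin_apply, Matrix.mulVec_mulVec, h.mul_incl,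
        Matrix.zero_mulVec]
    · change F.mulVec (E.mulVec w) = w
      rw [Matrix.mulVec_mulVec, h.proj_incl, Matrix.one_mulVec]
  have hφrn := LinearMap.finrank_range_add_finrank_ker φ
  rw [LinearMap.range_eq_top.mpr hφ, finrank_top, Module.finrank_fintype_fun_eq_card] at hφrn
  have hker : Module.finrank (ZMod 2) (LinearMap.ker φ) = A.rank := by
    have : (LinearMap.ker φ).map (Submodule.subtype _) = LinearMap.range A.mulVecLin := by
      ext v
      constructor
      · rintro ⟨⟨x, hx⟩, hFx, rfl⟩
        rw [LinearMap.mem_ker] at hx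
        have hFx : F.mulVec x = 0 := hFx
        have hx : A.mulVec x = 0 := hx
        refine ⟨s.mulVec x, ?_⟩
        change A.mulVec (s.mulVec x) = x
        conv_rhs => rw [← Matrix.one_mulVec x, ← h.homotopy, Matrix.add_mulVec, Matrix.add_mulVec,
          ← Matrix.mulVec_mulVec, ← Matrix.mulVec_mulVec, ← Matrix.mulVec_mulVec, hx, hFx,
          Matrix.mulVec_zero, Matrix.mulVec_zero, add_zero, add_zero]
      · rintro ⟨x, rfl⟩
        refine ⟨⟨A.mulVec x, ?_⟩, ?_, rfl⟩
        · change A.mulVec (A.mulVec x) = 0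
          rw [Matrix.mulVec_mulVec, h.sq_zero, Matrix.zero_mulVec]
        · change F.mulVec (A.mulVec x) = 0
          rw [Matrix.mulVec_mulVec, h.proj_mul, Matrix.zero_mulVec]
    rw [Matrix.rank, ← this]
    exact (Submodule.equivMapOfInjective _ (Submodule.injective_subtype _) _).finrank_eq
  have hA : Module.finrank (ZMod 2) (LinearMap.range A.mulVecLin) = A.rank := rfl
  omega

theorem Matrix.exists_mul_mul_eq_self {Q : Type*} [Fintype Q] [DecidableEq Q]
    (A : Matrix Q Q (ZMod 2)) : ∃ s : Matrix Q Q (ZMod 2), A * s * A = A := by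
  set f := A.mulVecLin
  obtain ⟨r, hr⟩ := LinearMap.exists_rightInverse_of_surjective f.rangeRestrict
    f.range_rangeRestrict
  obtain ⟨g, hg⟩ := LinearMap.exists_extend r
  refine ⟨LinearMap.toMatrix' g, ?_⟩
  apply Matrix.toLin'.injective
  rw [Matrix.toLin'_mul, Matrix.toLin'_mul, Matrix.toLin'_toMatrix']
  refine LinearMap.ext fun v => ?_
  change f (g (f v)) = f v
  have h1 : g (f v) = r (f.rangeRestrict v) := LinearMap.congr_fun hg (f.rangeRestrict v)
  rw [h1]
  exact congrArg Subtype.val (LinearMap.congr_fun hr (f.rangeRestrict v))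

theorem Matrix.exists_factorization_of_idempotent {Q : Type*} [Fintype Q] [DecidableEq Q]
    {P : Matrix Q Q (ZMod 2)} (hP : P * P = P) :
    ∃ (E : Matrix Q (Fin P.rank) (ZMod 2)) (F : Matrix (Fin P.rank) Q (ZMod 2)),
      E * F = P ∧ F * E = 1 := by
  set f := P.mulVecLin
  obtain ⟨b⟩ : Nonempty (Module.Basis (Fin P.rank) (ZMod 2) (LinearMap.range f)) :=
    ⟨Module.finBasis _ _⟩
  refine ⟨LinearMap.toMatrix' ((LinearMap.range f).subtype ∘ₗ b.equivFun.symm.toLinearMap),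
    LinearMap.toMatrix' (b.equivFun.toLinearMap ∘ₗ f.rangeRestrict), ?_, ?_⟩
  · rw [← LinearMap.toMatrix'_comp]
    apply Matrix.toLin'.injective
    rw [Matrix.toLin'_toMatrix']
    refine LinearMap.ext fun v => ?_
    simp [f]
  · rw [← LinearMap.toMatrix'_comp, ← LinearMap.toMatrix'_id]
    congr 1
    refine LinearMap.ext fun v => ?_
    have : f.rangeRestrict ((b.equivFun.symm v : LinearMap.range f) : Q → ZMod 2) =
        b.equivFun.symm v := by
      ext1
      obtain ⟨x, hx⟩ := (b.equivFun.symm v).2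
      rw [← hx]
      change P.mulVec (P.mulVec x) = P.mulVec x
      rw [Matrix.mulVec_mulVec, hP]
    simp only [LinearMap.comp_apply, LinearEquiv.coe_coe, Submodule.subtype_apply, this,
      LinearEquiv.apply_symm_apply, LinearMap.id_apply]

theorem exists_isHomologySplitting {Q : Type*} [Fintype Q] [DecidableEq Q]
    {A : Matrix Q Q (ZMod 2)} (hA : A * A = 0) :
    ∃ (h : ℕ) (s : Matrix Q Q (ZMod 2)) (E : Matrix Q (Fin h) (ZMod 2))
      (F : Matrix (Fin h) Q (ZMod 2)), IsHomologySplitting A s E F := by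
  obtain ⟨t, ht⟩ := A.exists_mul_mul_eq_self
  -- The correction of the generalized inverse t keeps AsA = A and makes (As)(sA) = 0. With A² = 0
  -- the idempotents As and sA become orthogonal, so P = 1 - As - sA is idempotent; it projects onto
  -- a copy of the homology.
  set s := t * (1 - t * A) with hs
  have hsA : s * A = t * A := by
    rw [hs, Matrix.mul_assoc, Matrix.sub_mul, Matrix.one_mul, Matrix.mul_assoc t A A, hA,
      Matrix.mul_zero, sub_zero]
  have hAsA : A * s * A = A := by rw [Matrix.mul_assoc, hsA, ← Matrix.mul_assoc, ht]
  have hAssA : A * s * (s * A) = 0 := by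
    have : (1 - t * A) * (t * A) = 0 := by
      rw [Matrix.sub_mul, Matrix.one_mul, sub_eq_zero, Matrix.mul_assoc, ← Matrix.mul_assoc A, ht]
    rw [hsA, hs, Matrix.mul_assoc, Matrix.mul_assoc, this, Matrix.mul_zero, Matrix.mul_zero]
  clear_value s
  obtain ⟨P, hP⟩ : ∃ P, P = 1 - A * s - s * A := ⟨_, rfl⟩
  have hAP : A * P = 0 := by
    rw [hP, Matrix.mul_sub, Matrix.mul_sub, Matrix.mul_one, ← Matrix.mul_assoc, hA,
      ← Matrix.mul_assoc, hAsA, Matrix.zero_mul, sub_zero, sub_self]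
  have hPA : P * A = 0 := by
    rw [hP, Matrix.sub_mul, Matrix.sub_mul, Matrix.one_mul, hAsA, Matrix.mul_assoc, hA,
      Matrix.mul_zero, sub_self, sub_zero]
  have hPsA : P * (s * A) = 0 := by
    rw [hP, Matrix.sub_mul, Matrix.sub_mul, Matrix.one_mul, hAssA, Matrix.mul_assoc s,
      ← Matrix.mul_assoc A, hAsA, sub_zero, sub_self]
  have hPP : P * P = P := by
    nth_rewrite 2 [hP]
    rw [Matrix.mul_sub, Matrix.mul_sub, Matrix.mul_one, ← Matrix.mul_assoc, hPA, hPsA,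
      Matrix.zero_mul, sub_zero, sub_zero]
  obtain ⟨E, F, hEF, hFE⟩ := Matrix.exists_factorization_of_idempotent hPP
  have hE : P * E = E :=
    calc P * E = E * F * E := by rw [hEF]
      _ = E := by rw [Matrix.mul_assoc, hFE, Matrix.mul_one]
  have hF : F * P = F :=
    calc F * P = F * (E * F) := by rw [hEF]
      _ = F := by rw [← Matrix.mul_assoc, hFE, Matrix.one_mul]
  refine ⟨_, s, E, F, hA, ?_, ?_, ?_, hFE⟩
  · rw [hEF, hP]; abel
  · rw [← hE, ← Matrix.mul_assoc, hAP, Matrix.zero_mul]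
  · rw [← hF, Matrix.mul_assoc, hPA, Matrix.mul_zero]

/-- The Künneth formula, in the form of a splitting of the product complex. -/
theorem IsHomologySplitting.prod {Q₁ Q₂ ι₁ ι₂ : Type*} [Fintype Q₁] [DecidableEq Q₁] [Fintype Q₂]
    [DecidableEq Q₂] [Fintype ι₁] [DecidableEq ι₁] [Fintype ι₂] [DecidableEq ι₂]
    {A₁ s₁ : Matrix Q₁ Q₁ (ZMod 2)} {E₁ : Matrix Q₁ ι₁ (ZMod 2)} {F₁ : Matrix ι₁ Q₁ (ZMod 2)}
    {A₂ s₂ : Matrix Q₂ Q₂ (ZMod 2)} {E₂ : Matrix Q₂ ι₂ (ZMod 2)} {F₂ : Matrix ι₂ Q₂ (ZMod 2)}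
    (h₁ : IsHomologySplitting A₁ s₁ E₁ F₁) (h₂ : IsHomologySplitting A₂ s₂ E₂ F₂) :
    IsHomologySplitting (A₁ ⊗ₖ (1 : Matrix Q₂ Q₂ (ZMod 2)) + (1 : Matrix Q₁ Q₁ (ZMod 2)) ⊗ₖ A₂)
      (s₁ ⊗ₖ (1 : Matrix Q₂ Q₂ (ZMod 2)) + (E₁ * F₁) ⊗ₖ s₂) (E₁ ⊗ₖ E₂) (F₁ ⊗ₖ F₂) where
  sq_zero := by
    simp only [add_mul, mul_add, ← Matrix.mul_kronecker_mul, h₁.sq_zero, h₂.sq_zero, one_mul,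
      mul_one, Matrix.zero_kronecker, Matrix.kronecker_zero, zero_add, add_zero]
    exact ZModModule.add_self _
  homotopy := by
    have h1 : A₁ * (E₁ * F₁) = 0 := by rw [← Matrix.mul_assoc, h₁.mul_incl, Matrix.zero_mul]
    have h2 : E₁ * F₁ * A₁ = 0 := by rw [Matrix.mul_assoc, h₁.proj_mul, Matrix.mul_zero]
    -- The mixed term occurs twice and cancels in characteristic 2, so no grading or sign is needed.
    -- The rest telescopes: (1 - E₁F₁) ⊗ 1 plus E₁F₁ ⊗ (1 - E₂F₂).
    have h3 : s₁ ⊗ₖ A₂ + s₁ ⊗ₖ A₂ = 0 := ZModModule.add_self _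
    have h4 : (A₁ * s₁ + s₁ * A₁ + E₁ * F₁) ⊗ₖ (1 : Matrix Q₂ Q₂ (ZMod 2)) = 1 := by
      rw [h₁.homotopy, Matrix.one_kronecker_one]
    have h5 : (E₁ * F₁) ⊗ₖ (A₂ * s₂ + s₂ * A₂ + E₂ * F₂) =
        (E₁ * F₁) ⊗ₖ (1 : Matrix Q₂ Q₂ (ZMod 2)) := by rw [h₂.homotopy]
    rw [Matrix.add_kronecker, Matrix.add_kronecker] at h4
    rw [Matrix.kronecker_add, Matrix.kronecker_add] at h5
    simp only [add_mul, mul_add, ← Matrix.mul_kronecker_mul, one_mul, mul_one, h1, h2,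
      Matrix.zero_kronecker, zero_add, add_zero]
    rw [← h4, ← h5, ← sub_eq_zero]
    refine Eq.trans ?_ h3
    abel
  mul_incl := by
    simp only [Matrix.add_mul, ← Matrix.mul_kronecker_mul, h₁.mul_incl, h₂.mul_incl,
      Matrix.zero_kronecker, Matrix.kronecker_zero, add_zero]
  proj_mul := by
    simp only [Matrix.mul_add, ← Matrix.mul_kronecker_mul, h₁.proj_mul, h₂.proj_mul,
      Matrix.zero_kronecker, Matrix.kronecker_zero, add_zero]
  proj_incl := by
    rw [← Matrix.mul_kronecker_mul, h₁.proj_incl, h₂.proj_incl, Matrix.one_kronecker_one]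

/-! ### Parameters of the code of a complex and of a product -/

namespace BinaryComplex

variable {Q Q₁ Q₂ : Type*} [Fintype Q] [Fintype Q₁] [Fintype Q₂]

theorem range_le_ker (K : BinaryComplex Q) :
    LinearMap.range K.δ.mulVecLin ≤ LinearMap.ker K.δ.mulVecLin := by
  rintro _ ⟨x, rfl⟩
  change K.δ.mulVec (K.δ.mulVec x) = 0
  rw [Matrix.mulVec_mulVec, K.sq_zero, Matrix.zero_mulVec]

theorem two_mul_rank_add_homDim (K : BinaryComplex Q) :
    2 * K.δ.rank + K.homDim = Fintype.card Q := by
  have h1 := LinearMap.finrank_range_add_finrank_ker K.δ.mulVecLin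
  rw [Module.finrank_fintype_fun_eq_card] at h1
  have h2 := Submodule.finrank_quotient_add_finrank
    ((LinearMap.range K.δ.mulVecLin).submoduleOf (LinearMap.ker K.δ.mulVecLin))
  rw [(Submodule.submoduleOfEquivOfLe K.range_le_ker).finrank_eq] at h2
  have h3 : Module.finrank (ZMod 2) (LinearMap.range K.δ.mulVecLin) = K.δ.rank := rfl
  rw [homDim]
  omega

/-- The Künneth formula for the homological dimension. -/
theorem homDim_prod [DecidableEq Q₁] [DecidableEq Q₂] (K₁ : BinaryComplex Q₁)
    (K₂ : BinaryComplex Q₂) : (K₁.prod K₂).homDim = K₁.homDim * K₂.homDim := by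
  obtain ⟨h₁, s₁, E₁, F₁, hs₁⟩ := exists_isHomologySplitting K₁.sq_zero
  obtain ⟨h₂, s₂, E₂, F₂, hs₂⟩ := exists_isHomologySplitting K₂.sq_zero
  have e₁ := hs₁.two_mul_rank_add_card
  have e₂ := hs₂.two_mul_rank_add_card
  have e := (hs₁.prod hs₂).two_mul_rank_add_card
  have d₁ := K₁.two_mul_rank_add_homDim
  have d₂ := K₂.two_mul_rank_add_homDim
  have d := (K₁.prod K₂).two_mul_rank_add_homDim
  rw [show (K₁.prod K₂).δ = K₁.δ ⊗ₖ (1 : Matrix Q₂ Q₂ (ZMod 2)) +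
    (1 : Matrix Q₁ Q₁ (ZMod 2)) ⊗ₖ K₂.δ from rfl] at d
  rw [Fintype.card_prod, Fintype.card_fin, Fintype.card_fin] at e
  rw [Fintype.card_fin] at e₁ e₂
  rw [show K₁.homDim = h₁ by omega, show K₂.homDim = h₂ by omega]
  omega

/-- The dual complex. -/
def transpose (K : BinaryComplex Q) : BinaryComplex Q where
  δ := K.δ.transpose
  sq_zero := by rw [← Matrix.transpose_mul, K.sq_zero, Matrix.transpose_zero]

theorem eq_of_boundary_eq {K K' : BinaryComplex Q} (h : K.δ = K'.δ) : K = K' := by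
  cases K; cases K'; congr

theorem transpose_prod [DecidableEq Q₁] [DecidableEq Q₂] (K₁ : BinaryComplex Q₁)
    (K₂ : BinaryComplex Q₂) : (K₁.prod K₂).transpose = K₁.transpose.prod K₂.transpose := by
  apply eq_of_boundary_eq
  simp only [transpose, prod, Matrix.transpose_add, ← Matrix.kroneckerMap_transpose,
    Matrix.transpose_one]

theorem CX_code (K : BinaryComplex Q) :
    K.code.CX = LinearMap.range K.transpose.δ.mulVecLin := by
  rw [Matrix.range_mulVecLin]; rfl

theorem CZ_code (K : BinaryComplex Q) : K.code.CZ = LinearMap.range K.δ.mulVecLin := by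
  rw [Matrix.range_mulVecLin]; rfl

theorem mem_binaryPerp_range_transpose (K : BinaryComplex Q) (v : Q → ZMod 2) :
    v ∈ binaryPerp (LinearMap.range K.transpose.δ.mulVecLin) ↔ K.δ.mulVec v = 0 := by
  have h : ∀ w, v ⬝ᵥ K.δ.transpose.mulVec w = K.δ.mulVec v ⬝ᵥ w := by
    intro w
    rw [Matrix.dotProduct_mulVec, Matrix.vecMul_transpose]
  constructor
  · intro hv
    refine dotProduct_eq_zero _ fun w => ?_
    rw [← h]
    exact hv _ ⟨w, rfl⟩
  · rintro hv _ ⟨w, rfl⟩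
    change v ⬝ᵥ K.δ.transpose.mulVec w = 0
    rw [h, hv, zero_dotProduct]

/-- Positive homological dimension provides a cycle that is not a boundary, so the minimum is
attained. -/
theorem exists_isLeast_weight (K : BinaryComplex Q) (hK : 0 < K.homDim) (w₀ : ℕ)
    (hw : ∀ v, K.δ.mulVec v = 0 → v ∉ LinearMap.range K.δ.mulVecLin → w₀ ≤ hammingNorm v) :
    ∃ d, w₀ ≤ d ∧ IsLeast {m : ℕ | ∃ v : Q → ZMod 2,
      v ∈ binaryPerp (LinearMap.range K.transpose.δ.mulVecLin) ∧
      v ∉ LinearMap.range K.δ.mulVecLin ∧ hammingNorm v = m} d := by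
  classical
  have hne : ∃ m : ℕ, ∃ v : Q → ZMod 2,
      v ∈ binaryPerp (LinearMap.range K.transpose.δ.mulVecLin) ∧
      v ∉ LinearMap.range K.δ.mulVecLin ∧ hammingNorm v = m := by
    by_contra! h
    have hle : LinearMap.ker K.δ.mulVecLin ≤ LinearMap.range K.δ.mulVecLin := by
      intro v hv
      by_contra hv'
      exact h _ v ((K.mem_binaryPerp_range_transpose v).mpr hv) hv' rfl
    have h1 := Submodule.finrank_mono hle
    have h2 := LinearMap.finrank_range_add_finrank_ker K.δ.mulVecLin
    rw [Module.finrank_fintype_fun_eq_card] at h2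
    have h3 := K.two_mul_rank_add_homDim
    have h4 : Module.finrank (ZMod 2) (LinearMap.range K.δ.mulVecLin) = K.δ.rank := rfl
    omega
  refine ⟨Nat.find hne, ?_, Nat.find_spec hne, fun m hm => Nat.find_min' hne hm⟩
  obtain ⟨v, hv, hv', h⟩ := Nat.find_spec hne
  rw [← h]
  exact hw v ((K.mem_binaryPerp_range_transpose v).mp hv) hv'

theorem exists_hasParameters_code (K : BinaryComplex Q) (hK : 0 < K.homDim) (w₀ w : ℕ)
    (hw : ∀ v, K.δ.mulVec v = 0 → v ∉ LinearMap.range K.δ.mulVecLin → w₀ ≤ hammingNorm v)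
    (hw' : ∀ v, K.transpose.δ.mulVec v = 0 → v ∉ LinearMap.range K.transpose.δ.mulVecLin →
      w₀ ≤ hammingNorm v)
    (hrow : ∀ i, hammingNorm (K.δ i) ≤ w) (hcol : ∀ j, hammingNorm (fun i => K.δ i j) ≤ w) :
    ∃ d, w₀ ≤ d ∧ K.code.HasParameters (Fintype.card Q) K.homDim d w := by
  have hrank : K.transpose.δ.rank = K.δ.rank := Matrix.rank_transpose _
  have hdim := K.two_mul_rank_add_homDim
  have hdim' := K.transpose.two_mul_rank_add_homDim
  obtain ⟨dZ, hdZ, hZ⟩ := K.exists_isLeast_weight hK w₀ hw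
  obtain ⟨dX, hdX, hX⟩ := K.transpose.exists_isLeast_weight (by omega) w₀ hw'
  refine ⟨min dX dZ, le_min hdX hdZ, rfl, ?_, ⟨dX, dZ, ?_, ?_, rfl⟩, hrow, hcol, hcol, hrow⟩
  · rw [CX_code, CZ_code]
    have h1 : Module.finrank (ZMod 2) (LinearMap.range K.δ.mulVecLin) = K.δ.rank := rfl
    have h2 : Module.finrank (ZMod 2) (LinearMap.range K.transpose.δ.mulVecLin) =
      K.transpose.δ.rank := rfl
    omega
  · rw [CSSCode.IsDistanceX, CX_code, CZ_code]; exact hX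
  · rw [CSSCode.IsDistanceZ, CX_code, CZ_code]; exact hZ

end BinaryComplex

theorem hammingNorm_uncurry {M : ℕ} (v : Fin M × Fin M → ZMod 2) :
    hammingNorm v = ∑ i, hammingNorm fun j => v (i, j) := by
  simp only [hammingNorm, Finset.card_filter]
  exact Fintype.sum_prod_type _

theorem prod_mulVec_apply {M : ℕ} (K₁ K₂ : BinaryComplex (Fin M))
    (X : Matrix (Fin M) (Fin M) (ZMod 2))
    (i j : Fin M) : (K₁.prod K₂).δ.mulVec (fun p => X p.1 p.2) (i, j) =
      (K₁.δ * X + X * K₂.δ.transpose) i j := by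
  simp only [BinaryComplex.prod, Matrix.add_mulVec, Pi.add_apply, Matrix.add_apply]
  congr 1
  · simp [Matrix.mulVec, dotProduct, Matrix.mul_apply, Fintype.sum_prod_type, Matrix.one_apply]
  · simp [Matrix.mulVec, dotProduct, Matrix.mul_apply, Fintype.sum_prod_type, Matrix.one_apply,
      mul_comm]

theorem le_hammingNorm_of_not_hasLightCycle {M a : ℕ} {K₁ K₂ : BinaryComplex (Fin M)}
    (h : ¬ HasLightCycle a K₁.δ K₂.δ) (v : Fin M × Fin M → ZMod 2)
    (hv : (K₁.prod K₂).δ.mulVec v = 0)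
    (hv' : v ∉ LinearMap.range (K₁.prod K₂).δ.mulVecLin) : (a + 1) ^ 2 ≤ hammingNorm v := by
  by_contra! hlt
  refine h ⟨Matrix.of fun i j => v (i, j), ?_, ?_, ?_⟩
  · ext i j
    rw [← prod_mulVec_apply]
    exact congrFun hv (i, j)
  · rintro ⟨Y, hY⟩
    refine hv' ⟨fun p => Y p.1 p.2, funext fun p => ?_⟩
    rw [Matrix.mulVecLin_apply, prod_mulVec_apply, ← hY]
    rfl
  · rw [hammingNorm_uncurry] at hlt
    exact hlt

/-- The row at p is supported on the grid row and the grid column through p. -/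
theorem hammingNorm_prod_row_le {M : ℕ} (K₁ K₂ : BinaryComplex (Fin M)) (p : Fin M × Fin M) :
    hammingNorm ((K₁.prod K₂).δ p) ≤ 2 * M := by
  classical
  have hsub : (Finset.univ.filter fun q => (K₁.prod K₂).δ p q ≠ 0) ⊆
      (Finset.univ.image fun i => (i, p.2)) ∪ (Finset.univ.image fun j => (p.1, j)) := by
    rintro ⟨i, j⟩ hq
    rw [Finset.mem_filter] at hq
    by_contra hne
    simp only [Finset.mem_union, Finset.mem_image, Finset.mem_univ, true_and, Prod.mk.injEq,
      not_or, not_exists, not_and] at hne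
    refine hq.2 ?_
    have h1 : p.2 ≠ j := hne.1 i rfl
    have h2 : p.1 ≠ i := fun h => hne.2 j h rfl
    simp [BinaryComplex.prod, Matrix.kroneckerMap_apply, h1, h2]
  refine (Finset.card_le_card hsub).trans ((Finset.card_union_le _ _).trans ?_)
  have h1 := Finset.card_image_le (s := (Finset.univ : Finset (Fin M))) (f := fun i => (i, p.2))
  have h2 := Finset.card_image_le (s := (Finset.univ : Finset (Fin M))) (f := fun j => (p.1, j))
  rw [Finset.card_univ, Fintype.card_fin] at h1 h2
  omega

/-- If neither the product complex nor its dual has a light nontrivial cycle, the product code has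
large distance. -/
theorem exists_hasParameters_prod {M H a : ℕ} (hH : 0 < H) (K₁ K₂ : ComplexWithHomDim M H)
    (h : ¬ HasLightCycle a K₁.1.δ K₂.1.δ)
    (h' : ¬ HasLightCycle a K₁.1.δ.transpose K₂.1.δ.transpose) :
    ∃ d, (a + 1) ^ 2 ≤ d ∧ (K₁.1.prod K₂.1).code.HasParameters (M ^ 2) (H ^ 2) d (2 * M) := by
  have hdim : (K₁.1.prod K₂.1).homDim = H ^ 2 := by
    rw [BinaryComplex.homDim_prod, K₁.2, K₂.2, sq]
  have hcol : ∀ q, hammingNorm (fun p => (K₁.1.prod K₂.1).δ p q) ≤ 2 * M := by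
    intro q
    have := hammingNorm_prod_row_le K₁.1.transpose K₂.1.transpose q
    rw [← BinaryComplex.transpose_prod] at this
    exact this
  have := (K₁.1.prod K₂.1).exists_hasParameters_code (by rw [hdim]; positivity) ((a + 1) ^ 2)
    (2 * M) (le_hammingNorm_of_not_hasLightCycle h) ?_ (hammingNorm_prod_row_le _ _) hcol
  · rw [hdim, Fintype.card_prod, Fintype.card_fin, ← sq] at this
    exact this
  · rw [BinaryComplex.transpose_prod]
    exact le_hammingNorm_of_not_hasLightCycle h'

/-! ### Relabelling and lengthening CSS codes -/

theorem CSSCode.span_submatrix {R R' Q Q' : Type*} (A : Matrix R Q (ZMod 2)) (eR : R' ≃ R) (e : Q' ≃ Q) :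
    Submodule.span (ZMod 2) (Set.range fun i => A.submatrix eR e i) =
      (Submodule.span (ZMod 2) (Set.range fun i => A i)).map
        (LinearEquiv.funCongrLeft (ZMod 2) (ZMod 2) e).toLinearMap := by
  rw [Submodule.map_span, ← Set.range_comp, ← eR.surjective.range_comp]
  rfl

section Reindex

variable {Q Q' : Type*} [Fintype Q] [Fintype Q']

theorem hammingNorm_comp_equiv (e : Q' ≃ Q) (v : Q → ZMod 2) :
    hammingNorm (fun q => v (e q)) = hammingNorm v := by
  simp only [hammingNorm, Finset.card_filter]
  exact Equiv.sum_comp e fun q => if v q ≠ 0 then 1 else 0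

theorem mem_binaryPerp_map_funCongrLeft (e : Q' ≃ Q) (C : Submodule (ZMod 2) (Q → ZMod 2))
    (v : Q → ZMod 2) :
    LinearEquiv.funCongrLeft (ZMod 2) (ZMod 2) e v ∈
      binaryPerp (C.map (LinearEquiv.funCongrLeft (ZMod 2) (ZMod 2) e).toLinearMap) ↔
    v ∈ binaryPerp C := by
  have hdot : ∀ f : Q → ZMod 2, LinearEquiv.funCongrLeft (ZMod 2) (ZMod 2) e v ⬝ᵥ
      LinearEquiv.funCongrLeft (ZMod 2) (ZMod 2) e f = v ⬝ᵥ f := fun f =>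
    Equiv.sum_comp e fun q => v q * f q
  constructor
  · intro h f hf
    rw [← hdot]
    exact h _ ⟨f, hf, rfl⟩
  · rintro h _ ⟨f, hf, rfl⟩
    exact (hdot f).trans (h f hf)

theorem weights_map_funCongrLeft (e : Q' ≃ Q) (C D : Submodule (ZMod 2) (Q → ZMod 2)) :
    {m : ℕ | ∃ v : Q' → ZMod 2,
      v ∈ binaryPerp (C.map (LinearEquiv.funCongrLeft (ZMod 2) (ZMod 2) e).toLinearMap) ∧
      v ∉ D.map (LinearEquiv.funCongrLeft (ZMod 2) (ZMod 2) e).toLinearMap ∧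
      hammingNorm v = m} =
    {m : ℕ | ∃ v : Q → ZMod 2, v ∈ binaryPerp C ∧ v ∉ D ∧ hammingNorm v = m} := by
  ext m
  refine (LinearEquiv.funCongrLeft (ZMod 2) (ZMod 2) e).surjective.exists.trans
    (exists_congr fun v => and_congr (mem_binaryPerp_map_funCongrLeft e C v)
      (and_congr (not_congr ?_) ?_))
  · exact (LinearEquiv.funCongrLeft (ZMod 2) (ZMod 2) e).injective.mem_set_image
  · rw [← hammingNorm_comp_equiv e v]; rfl

namespace CSSCode

variable {RX RZ RX' RZ' : Type*}

/-- Relabel the rows and the qubits of a CSS code. -/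
def reindex (C : CSSCode RX RZ Q) (eX : RX' ≃ RX) (eZ : RZ' ≃ RZ) (e : Q' ≃ Q) :
    CSSCode RX' RZ' Q' where
  AX := C.AX.submatrix eX e
  AZ := C.AZ.submatrix eZ e
  orthogonal := by
    rw [Matrix.transpose_submatrix, Matrix.submatrix_mul_equiv, C.orthogonal,
      Matrix.submatrix_zero]
    rfl

theorem HasParameters.reindex [Fintype RX] [Fintype RZ] [Fintype RX'] [Fintype RZ']
    {C : CSSCode RX RZ Q} {n k d w : ℕ} (h : C.HasParameters n k d w)
    (eX : RX' ≃ RX) (eZ : RZ' ≃ RZ) (e : Q' ≃ Q) :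
    (C.reindex eX eZ e).HasParameters n k d w := by
  obtain ⟨hn, hk, ⟨dX, dZ, hX, hZ, hd⟩, h1, h2, h3, h4⟩ := h
  have hCX : (C.reindex eX eZ e).CX =
      C.CX.map (LinearEquiv.funCongrLeft (ZMod 2) (ZMod 2) e).toLinearMap :=
    span_submatrix C.AX eX e
  have hCZ : (C.reindex eX eZ e).CZ =
      C.CZ.map (LinearEquiv.funCongrLeft (ZMod 2) (ZMod 2) e).toLinearMap :=
    span_submatrix C.AZ eZ e
  refine ⟨(Fintype.card_congr e).trans hn, ?_, ⟨dX, dZ, ?_, ?_, hd⟩, ?_, ?_, ?_, ?_⟩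
  · rw [hCX, hCZ, LinearEquiv.finrank_map_eq, LinearEquiv.finrank_map_eq, hk]
  · rw [IsDistanceX, hCX, hCZ, weights_map_funCongrLeft]; exact hX
  · rw [IsDistanceZ, hCX, hCZ, weights_map_funCongrLeft]; exact hZ
  · exact fun i => (hammingNorm_comp_equiv e (C.AX (eX i))).trans_le (h1 _)
  · exact fun q => (hammingNorm_comp_equiv eX fun i => C.AX i (e q)).trans_le (h2 _)
  · exact fun i => (hammingNorm_comp_equiv e (C.AZ (eZ i))).trans_le (h3 _)
  · exact fun q => (hammingNorm_comp_equiv eZ fun i => C.AZ i (e q)).trans_le (h4 _)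

variable {E : Type*} [Fintype E] [DecidableEq E]

/-- Add qubits `E`, each stabilized by a single-qubit `X`-type check. -/
def pad (C : CSSCode RX RZ Q) (E : Type*) [Fintype E] [DecidableEq E] :
    CSSCode (RX ⊕ E) RZ (Q ⊕ E) where
  AX := Matrix.fromBlocks C.AX 0 0 1
  AZ := Matrix.fromCols C.AZ 0
  orthogonal := by
    rw [Matrix.transpose_fromCols, Matrix.fromBlocks_mul_fromRows, C.orthogonal]
    ext (i | i) j <;> simp

theorem hammingNorm_sum {α β : Type*} [Fintype α] [Fintype β] (v : α ⊕ β → ZMod 2) :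
    hammingNorm v = hammingNorm (fun a => v (.inl a)) + hammingNorm fun b => v (.inr b) := by
  simp only [hammingNorm, Finset.card_filter]
  exact Fintype.sum_sum_type _

/-- The restriction of a vector to the original qubits. -/
def restrictInl (Q E : Type*) : (Q ⊕ E → ZMod 2) →ₗ[ZMod 2] (Q → ZMod 2) :=
  LinearMap.funLeft (ZMod 2) (ZMod 2) Sum.inl

/-- The extension of a vector by zero to the additional qubits. -/
def extendInl (Q E : Type*) : (Q → ZMod 2) →ₗ[ZMod 2] (Q ⊕ E → ZMod 2) where
  toFun v := Sum.elim v 0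
  map_add' v w := by ext (i | i) <;> simp
  map_smul' c v := by ext (i | i) <;> simp

theorem extendInl_injective (Q E : Type*) : Function.Injective (extendInl Q E) :=
  fun _ _ h => funext fun q => congrFun h (.inl q)

theorem CZ_pad (C : CSSCode RX RZ Q) : (C.pad E).CZ = C.CZ.map (extendInl Q E) := by
  rw [CZ, CZ, Submodule.map_span, ← Set.range_comp]
  congr 2

/-- The single-qubit checks generate every vector on the new qubits, so those coordinates are
unconstrained in C^X. Consequently the orthogonal vectors vanish there, and neither distance
changes. -/
theorem CX_pad (C : CSSCode RX RZ Q) : (C.pad E).CX = C.CX.comap (restrictInl Q E) := by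
  apply le_antisymm
  · rw [CX, Submodule.span_le]
    rintro _ ⟨i | i, rfl⟩
    · exact Submodule.subset_span ⟨i, rfl⟩
    · have : restrictInl Q E ((C.pad E).AX (.inr i)) = 0 := rfl
      rw [SetLike.mem_coe, Submodule.mem_comap, this]
      exact Submodule.zero_mem _
  · intro v hv
    have hext : C.CX.map (extendInl Q E) ≤ (C.pad E).CX := by
      rw [CX, Submodule.map_span, Submodule.span_le]
      rintro _ ⟨_, ⟨i, rfl⟩, rfl⟩
      refine Submodule.subset_span ⟨.inl i, ?_⟩
      ext (q | q) <;> rfl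
    have hv' : v = extendInl Q E (restrictInl Q E v) +
        ∑ x : E, v (.inr x) • (C.pad E).AX (.inr x) := by
      ext (q | q)
      · simp [extendInl, restrictInl, pad, LinearMap.funLeft]
      · simp [extendInl, pad, Matrix.one_apply]
    rw [hv']
    exact Submodule.add_mem _ (hext ⟨_, hv, rfl⟩) (Submodule.sum_mem _ fun x _ =>
      Submodule.smul_mem _ _ (Submodule.subset_span ⟨.inr x, rfl⟩))

theorem finrank_CX_pad (C : CSSCode RX RZ Q) :
    Module.finrank (ZMod 2) (C.pad E).CX =
      Module.finrank (ZMod 2) C.CX + Fintype.card E := by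
  rw [CX_pad]
  let φ : (C.CX.comap (restrictInl Q E)) ≃ₗ[ZMod 2] C.CX × (E → ZMod 2) :=
    { toFun := fun v => (⟨restrictInl Q E v.1, v.2⟩, fun x => v.1 (.inr x))
      map_add' := fun _ _ => rfl
      map_smul' := fun _ _ => rfl
      invFun := fun p => ⟨Sum.elim p.1.1 p.2, p.1.2⟩
      left_inv := by
        intro v
        ext (q | q) <;> rfl
      right_inv := fun _ => rfl }
  rw [φ.finrank_eq, Module.finrank_prod, Module.finrank_fintype_fun_eq_card]

theorem mem_binaryPerp_CX_pad (C : CSSCode RX RZ Q) (v : Q ⊕ E → ZMod 2) :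
    v ∈ binaryPerp (C.pad E).CX ↔
      restrictInl Q E v ∈ binaryPerp C.CX ∧ ∀ x, v (.inr x) = 0 := by
  rw [CX_pad]
  constructor
  · intro h
    refine ⟨fun f hf => ?_, fun x => ?_⟩
    · have := h (Sum.elim f 0) hf
      simpa [dotProduct, restrictInl, LinearMap.funLeft] using this
    · have := h (Sum.elim 0 (Pi.single x 1)) (Submodule.zero_mem C.CX)
      simpa [dotProduct, Pi.single_apply] using this
  · rintro ⟨h, h0⟩ f hf
    have := h _ hf
    simpa [dotProduct, restrictInl, LinearMap.funLeft, h0] using this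

theorem mem_binaryPerp_CZ_pad (C : CSSCode RX RZ Q) (v : Q ⊕ E → ZMod 2) :
    v ∈ binaryPerp (C.pad E).CZ ↔ restrictInl Q E v ∈ binaryPerp C.CZ := by
  have hdot : ∀ f, v ⬝ᵥ extendInl Q E f = restrictInl Q E v ⬝ᵥ f := by
    intro f
    simp [dotProduct, extendInl, restrictInl, LinearMap.funLeft]
  rw [CZ_pad]
  constructor
  · intro h f hf
    rw [← hdot]
    exact h _ ⟨f, hf, rfl⟩
  · rintro h _ ⟨f, hf, rfl⟩
    exact (hdot f).trans (h f hf)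

theorem HasParameters.pad [Fintype RX] [Fintype RZ] {C : CSSCode RX RZ Q} {n k d w : ℕ}
    (h : C.HasParameters n k d w)
    (hw : 1 ≤ w) : (C.pad E).HasParameters (n + Fintype.card E) k d w := by
  obtain ⟨hn, hk, ⟨dX, dZ, hX, hZ, hd⟩, h1, h2, h3, h4⟩ := h
  have hsingle : ∀ x : E, hammingNorm (fun y => (1 : Matrix E E (ZMod 2)) x y) ≤ 1 := by
    intro x
    rw [hammingNorm, Finset.card_le_one]
    intro y hy z hz
    simp only [Finset.mem_filter, Matrix.one_apply, ne_eq, ite_eq_right_iff,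
      Classical.not_imp] at hy hz
    exact hy.2.1.symm.trans hz.2.1
  have hsingle' : ∀ x : E, hammingNorm (fun y => (1 : Matrix E E (ZMod 2)) y x) ≤ 1 := by
    intro x
    have := hsingle x
    rwa [← Matrix.transpose_one] at this
  refine ⟨by rw [Fintype.card_sum, hn], ?_, ⟨dX, dZ, ⟨?_, ?_⟩, ⟨?_, ?_⟩, hd⟩, ?_, ?_, ?_, ?_⟩
  · rw [finrank_CX_pad, CZ_pad,
      ← (Submodule.equivMapOfInjective _ (extendInl_injective Q E) C.CZ).finrank_eq]
    omega
  · obtain ⟨v, hv, hv', hvw⟩ := hX.1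
    refine ⟨extendInl Q E v, (C.mem_binaryPerp_CZ_pad _).mpr hv, ?_, ?_⟩
    · rw [CX_pad]; exact hv'
    · rw [hammingNorm_sum, ← hvw]
      exact (congrArg _ hammingNorm_zero).trans (add_zero _)
  · rintro _ ⟨v, hv, hv', rfl⟩
    rw [CX_pad] at hv'
    rw [hammingNorm_sum]
    exact (hX.2 ⟨_, (C.mem_binaryPerp_CZ_pad _).mp hv, hv', rfl⟩).trans (Nat.le_add_right _ _)
  · obtain ⟨v, hv, hv', hvw⟩ := hZ.1
    refine ⟨extendInl Q E v, (C.mem_binaryPerp_CX_pad _).mpr ⟨hv, fun _ => rfl⟩, ?_, ?_⟩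
    · rw [CZ_pad]
      rintro ⟨u, hu, huv⟩
      exact hv' (extendInl_injective Q E huv ▸ hu)
    · rw [hammingNorm_sum, ← hvw]
      exact (congrArg _ hammingNorm_zero).trans (add_zero _)
  · rintro _ ⟨v, hv, hv', rfl⟩
    obtain ⟨hv1, hv0⟩ := (C.mem_binaryPerp_CX_pad _).mp hv
    rw [hammingNorm_sum]
    refine (hZ.2 ⟨_, hv1, fun h => hv' ?_, rfl⟩).trans (Nat.le_add_right _ _)
    rw [CZ_pad]
    refine ⟨_, h, ?_⟩
    ext (q | q)
    · rfl
    · exact (hv0 q).symm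
  · rintro (i | i) <;> rw [hammingNorm_sum]
    · exact (congrArg _ hammingNorm_zero).trans_le (h1 i)
    · refine (congrArg (· + _) hammingNorm_zero).trans_le ?_
      rw [zero_add]
      exact (hsingle i).trans hw
  · rintro (i | i) <;> rw [hammingNorm_sum]
    · exact (congrArg _ hammingNorm_zero).trans_le (h2 i)
    · refine (congrArg (· + _) hammingNorm_zero).trans_le ?_
      rw [zero_add]
      exact (hsingle' i).trans hw
  · intro i
    rw [hammingNorm_sum]
    exact (congrArg _ hammingNorm_zero).trans_le (h3 i)
  · rintro (i | i)
    · exact h4 i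
    · exact hammingNorm_zero.trans_le (Nat.zero_le w)

/-- Any code can be lengthened without changing its dimension and distance. -/
theorem HasParameters.exists_of_le [Fintype RX] [Fintype RZ] {C : CSSCode RX RZ Q}
    {n n' k d w : ℕ}
    (h : C.HasParameters n k d w) (hw : 1 ≤ w) (hn : n ≤ n') :
    ∃ (rX rZ : ℕ) (C' : CSSCode (Fin rX) (Fin rZ) (Fin n')), C'.HasParameters n' k d w := by
  have hp := h.pad (E := Fin (n' - n)) hw
  rw [Fintype.card_fin, Nat.add_sub_cancel' hn] at hp
  exact ⟨_, _, _, hp.reindex (Fintype.equivFin _).symm (Fintype.equivFin _).symm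
    (Fintype.equivFinOfCardEq hp.1).symm⟩

end CSSCode

end Reindex

/-! ### Entropy estimate, probability bound and choice of constants -/

theorem squareZeroMatrices_nonempty {M L : ℕ} (h : 2 * L ≤ M) :
    (squareZeroMatrices M L).Nonempty := by
  let sel : (Fin L → Fin M) → Matrix (Fin M) (Fin L) (ZMod 2) :=
    fun p => Matrix.of fun i k => if i = p k then 1 else 0
  have hsel : ∀ (p q : Fin L → Fin M) k l,
      ((sel p).transpose * sel q) k l = if p k = q l then 1 else 0 := by
    intro p q k l
    simp [sel, Matrix.mul_apply, eq_comm]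
  let p : Fin L → Fin M := fun k => ⟨k, by omega⟩
  let q : Fin L → Fin M := fun k => ⟨k + L, by omega⟩
  have hpq : (sel p).transpose * sel q = 0 := by
    ext k l
    rw [hsel, if_neg]
    · rfl
    · intro h
      have := congrArg Fin.val h
      simp only [p, q] at this
      omega
  have hone : ∀ r : Fin L → Fin M, Function.Injective r → (sel r).transpose * sel r = 1 := by
    intro r hr
    ext k l
    rw [hsel, Matrix.one_apply]
    simp [hr.eq_iff]
  have hp : Function.Injective p := fun k l h => by
    have := congrArg Fin.val h
    exact Fin.ext this
  have hq : Function.Injective q := fun k l h => by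
    have := congrArg Fin.val h
    simp only [q] at this
    exact Fin.ext (by omega)
  -- This matrix sends the k-th basis vector to the (k+L)-th for k < L and kills the others.
  refine ⟨sel q * (sel p).transpose, ?_, le_antisymm ?_ ?_⟩
  · rw [Matrix.mul_assoc, ← Matrix.mul_assoc (sel p).transpose, hpq, Matrix.zero_mul,
      Matrix.mul_zero]
  · exact (Matrix.rank_mul_le_left _ _).trans ((sel q).rank_le_card_width.trans (by simp))
  · have h1 : (sel q).transpose * (sel q * (sel p).transpose) * sel p = 1 := by
      rw [← Matrix.mul_assoc, hone q hq, Matrix.one_mul, hone p hp]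
    calc L = (1 : Matrix (Fin L) (Fin L) (ZMod 2)).rank := by rw [Matrix.rank_one, Fintype.card_fin]
      _ ≤ ((sel q).transpose * (sel q * (sel p).transpose)).rank := by
        rw [← h1]; exact Matrix.rank_mul_le_left _ _
      _ ≤ (sel q * (sel p).transpose).rank := Matrix.rank_mul_le_right _ _

/-- A Chernoff bound: weight each set t by x^|t| with x = 2^(-12). The total is (1 + x)^M ≤
exp(M/4096), and e ≤ 4 turns this into a power of 2. -/
theorem card_lightVector_le (M a : ℕ) :
    Nat.card (LightVector M a) ≤ 2 ^ (12 * a + 2 * (M / 4096 + 1)) := by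
  have h1 : Nat.card (LightVector M a) ≤
      (Finset.univ.filter fun t : Finset (Fin M) => t.card ≤ a).card := by
    rw [← Fintype.card_subtype, ← Nat.card_eq_fintype_card]
    refine Nat.card_le_card_of_injective
      (fun v => ⟨Finset.univ.filter fun i => v.1 i ≠ 0, v.2⟩) fun v w h => ?_
    have hbit : ∀ x y : ZMod 2, (x ≠ 0 ↔ y ≠ 0) → x = y := by decide
    refine Subtype.ext (funext fun i => hbit _ _ ?_)
    have := Finset.ext_iff.mp (congrArg Subtype.val h) i
    simpa using this
  have h2 : ((Finset.univ.filter fun t : Finset (Fin M) => t.card ≤ a).card : ℝ) *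
      (1 / 4096) ^ a ≤ (1 / 4096 + 1) ^ M := by
    calc _ = ∑ t ∈ Finset.univ.filter (fun t : Finset (Fin M) => t.card ≤ a),
          (1 / 4096 : ℝ) ^ a := by rw [Finset.sum_const, nsmul_eq_mul]
      _ ≤ ∑ t ∈ Finset.univ.filter (fun t : Finset (Fin M) => t.card ≤ a),
          (1 / 4096 : ℝ) ^ t.card := Finset.sum_le_sum fun t ht =>
            pow_le_pow_of_le_one (by norm_num) (by norm_num) (Finset.mem_filter.mp ht).2
      _ ≤ ∑ t : Finset (Fin M), (1 / 4096 : ℝ) ^ t.card :=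
          Finset.sum_le_sum_of_subset_of_nonneg (Finset.filter_subset _ _)
            fun _ _ _ => by positivity
      _ = (1 / 4096 + 1) ^ M := by
          have := Fintype.sum_pow_mul_eq_add_pow (Fin M) (1 / 4096 : ℝ) 1
          simpa using this
  have h3 : (1 / 4096 + 1 : ℝ) ^ M ≤ 2 ^ (2 * (M / 4096 + 1)) := by
    have hM : (M : ℝ) ≤ 4096 * ((M / 4096 + 1 : ℕ) : ℝ) := by
      have : M ≤ 4096 * (M / 4096 + 1) := by omega
      exact_mod_cast this
    calc (1 / 4096 + 1 : ℝ) ^ M ≤ Real.exp (1 / 4096) ^ M :=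
          pow_le_pow_left₀ (by norm_num) (Real.add_one_le_exp _) _
      _ = Real.exp (M * (1 / 4096)) := (Real.exp_nat_mul _ _).symm
      _ ≤ Real.exp ((M / 4096 + 1 : ℕ) * 1) := Real.exp_le_exp.mpr (by linarith)
      _ = Real.exp 1 ^ (M / 4096 + 1) := Real.exp_nat_mul _ _
      _ ≤ (2 ^ 2) ^ (M / 4096 + 1) := by
          refine pow_le_pow_left₀ (Real.exp_pos _).le ?_ _
          linarith [Real.exp_one_lt_d9]
      _ = 2 ^ (2 * (M / 4096 + 1)) := (pow_mul _ _ _).symm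
  have h4 : ((Finset.univ.filter fun t : Finset (Fin M) => t.card ≤ a).card : ℝ) ≤
      2 ^ (12 * a + 2 * (M / 4096 + 1)) := by
    have h5 : (1 / 4096 : ℝ) ^ a * 2 ^ (12 * a) = 1 := by
      rw [pow_mul, ← mul_pow]; norm_num
    calc _ = ((Finset.univ.filter fun t : Finset (Fin M) => t.card ≤ a).card : ℝ) *
          ((1 / 4096 : ℝ) ^ a * 2 ^ (12 * a)) := by rw [h5, mul_one]
      _ = (((Finset.univ.filter fun t : Finset (Fin M) => t.card ≤ a).card : ℝ) *
          (1 / 4096 : ℝ) ^ a) * 2 ^ (12 * a) := by ring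
      _ ≤ 2 ^ (2 * (M / 4096 + 1)) * 2 ^ (12 * a) := by
          refine mul_le_mul_of_nonneg_right (h2.trans h3) (by positivity)
      _ = 2 ^ (12 * a + 2 * (M / 4096 + 1)) := by rw [pow_add, mul_comm]
  exact h1.trans (by exact_mod_cast h4)

/-- Complexes of size `M` and homological dimension `H` are square-zero matrices of rank `L`, where
`M = H + 2 L`. -/
def complexEquivSquareZero {M H L : ℕ} (h : 2 * L + H = M) :
    ComplexWithHomDim M H ≃ squareZeroMatrices M L where
  toFun K := ⟨K.1.δ, K.1.sq_zero, by
    have h1 := K.1.two_mul_rank_add_homDim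
    have h2 := K.2
    rw [Fintype.card_fin] at h1
    omega⟩
  invFun A := ⟨⟨A.1, A.2.1⟩, by
    have h1 := (⟨A.1, A.2.1⟩ : BinaryComplex (Fin M)).two_mul_rank_add_homDim
    have h2 := A.2.2
    rw [Fintype.card_fin] at h1
    simp only at h1
    omega⟩
  left_inv _ := rfl
  right_inv _ := rfl

theorem one_sub_le_productProbability {M H L a b : ℕ} (h : 2 * L + H = M) (hab : a ≤ b)
    (hb : Nat.card (LightVector M a) ≤ 2 ^ b) (hM : M ≤ 2 ^ b) (hN : 3 * (24 * b) + 2 ≤ L)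
    (P : BinaryComplex (Fin M × Fin M) → Prop)
    (hP : ∀ K₁ K₂ : ComplexWithHomDim M H, ¬ HasLightCycle a K₁.1.δ K₂.1.δ →
      ¬ HasLightCycle a K₁.1.δ.transpose K₂.1.δ.transpose → P (K₁.1.prod K₂.1)) :
    1 - 8 * (1 / 2 : ℝ) ^ (12 * b) ≤ productProbability M H P := by
  set S := squareZeroMatrices M L
  let e := complexEquivSquareZero h
  have hfin : Finite (ComplexWithHomDim M H) := Finite.of_equiv _ e.symm
  have hcard : Nat.card (ComplexWithHomDim M H × ComplexWithHomDim M H) = S.ncard ^ 2 := by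
    rw [Nat.card_prod, Nat.card_congr e, Nat.card_coe_set_eq, sq]
  have hpos : 0 < S.ncard := by
    rw [Set.ncard_pos]
    exact squareZeroMatrices_nonempty (by omega)
  set G : Set (ComplexWithHomDim M H × ComplexWithHomDim M H) :=
    {K | P (K.1.1.prod K.2.1)}
  set B := {p ∈ S ×ˢ S | HasLightCycle a p.1 p.2} with hB
  set B₁ : Set (ComplexWithHomDim M H × ComplexWithHomDim M H) :=
    {K | HasLightCycle a K.1.1.δ K.2.1.δ}
  set B₂ : Set (ComplexWithHomDim M H × ComplexWithHomDim M H) :=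
    {K | HasLightCycle a K.1.1.δ.transpose K.2.1.δ.transpose}
  have hB₁ : B₁.ncard ≤ B.ncard := by
    refine Set.ncard_le_ncard_of_injOn (fun K => (K.1.1.δ, K.2.1.δ)) ?_ ?_
    · intro K hK
      exact ⟨⟨(e K.1).2, (e K.2).2⟩, hK⟩
    · intro K _ K' _ hKK
      obtain ⟨h1, h2⟩ := Prod.mk.inj hKK
      exact Prod.ext (e.injective (Subtype.ext h1)) (e.injective (Subtype.ext h2))
  have htr : ∀ A ∈ S, A.transpose ∈ S := fun A hA =>
    ⟨by rw [← Matrix.transpose_mul, hA.1, Matrix.transpose_zero], by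
      rw [Matrix.rank_transpose, hA.2]⟩
  have hB₂ : B₂.ncard ≤ B.ncard := by
    refine Set.ncard_le_ncard_of_injOn (fun K => (K.1.1.δ.transpose, K.2.1.δ.transpose)) ?_ ?_
    · intro K hK
      exact ⟨⟨htr _ (e K.1).2, htr _ (e K.2).2⟩, hK⟩
    · intro K _ K' _ hKK
      obtain ⟨h1, h2⟩ := Prod.mk.inj hKK
      exact Prod.ext (e.injective (Subtype.ext (Matrix.transpose_injective h1)))
        (e.injective (Subtype.ext (Matrix.transpose_injective h2)))
  -- Transposition permutes the ensemble, so light cycles of the dual are as rare as those of the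
  -- product. Two families of bad pairs turn the factor 4 into 8.
  have hunion : S.ncard ^ 2 ≤ G.ncard + 2 * B.ncard := by
    rw [← hcard, ← Set.ncard_univ]
    have hsub : (Set.univ : Set (ComplexWithHomDim M H × ComplexWithHomDim M H)) ⊆
        G ∪ (B₁ ∪ B₂) := by
      rintro ⟨K₁, K₂⟩ -
      by_contra hne
      simp only [Set.mem_union, not_or] at hne
      exact hne.1 (hP K₁ K₂ hne.2.1 hne.2.2)
    have h1 := Set.ncard_le_ncard hsub (Set.toFinite _)
    have h2 := Set.ncard_union_le G (B₁ ∪ B₂)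
    have h3 := Set.ncard_union_le B₁ B₂
    omega
  have hlight := ncard_hasLightCycle_le hab hb hM hN (show L ≤ M by omega)
  have hreal : (B.ncard : ℝ) * 2 ^ (12 * b) ≤ 4 * (S.ncard : ℝ) ^ 2 := by exact_mod_cast hlight
  have hunion' : (S.ncard : ℝ) ^ 2 ≤ G.ncard + 2 * B.ncard := by exact_mod_cast hunion
  have hBle : (B.ncard : ℝ) ≤ 4 * (S.ncard : ℝ) ^ 2 * (1 / 2) ^ (12 * b) := by
    rw [one_div, inv_pow, ← div_eq_mul_inv, le_div_iff₀ (by positivity)]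
    exact hreal
  have hprob : productProbability M H P = (G.ncard : ℝ) / (S.ncard : ℝ) ^ 2 := by
    rw [productProbability, hcard, Nat.cast_pow]
    rfl
  rw [hprob, le_div_iff₀ (by positivity)]
  linarith

theorem productProbability_le_one (M H : ℕ) (P : BinaryComplex (Fin M × Fin M) → Prop) :
    productProbability M H P ≤ 1 := by
  have hinj : Function.Injective fun K : ComplexWithHomDim M H => K.1.δ :=
    fun K K' h => Subtype.ext (BinaryComplex.eq_of_boundary_eq h)
  have hfin : Finite (ComplexWithHomDim M H) := Finite.of_injective _ hinj
  refine div_le_one_of_le₀ ?_ (Nat.cast_nonneg _)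
  exact_mod_cast Nat.card_le_card_of_injective _ Subtype.val_injective

theorem mul_succ_le_two_pow {b : ℕ} (hb : 14 ≤ b) : 512 * (b + 1) ≤ 2 ^ b := by
  induction b, hb using Nat.le_induction with
  | base => norm_num
  | succ b hb ih => rw [pow_succ]; omega

theorem theorem1 :
    ∃ c₁ c₂ c₃ : ℝ, 0 < c₁ ∧ 0 < c₂ ∧ 0 < c₃ ∧
      (∀ᶠ n : ℕ in atTop, ∃ (rX rZ : ℕ) (C : CSSCode (Fin rX) (Fin rZ) (Fin n)) (k d w : ℕ),
        C.HasParameters n k d w ∧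
        c₁ * (n : ℝ) ≤ (k : ℝ) ∧ c₂ * (n : ℝ) ≤ (d : ℝ) ∧ (w : ℝ) ≤ c₃ * √(n : ℝ)) ∧
      (∃ (ρ : ℝ) (H : ℕ → ℕ), 0 < ρ ∧
        Tendsto (fun M : ℕ => (H M : ℝ) / (M : ℝ)) atTop (𝓝 ρ) ∧
        (∀ᶠ M : ℕ in atTop, c₁ * (M : ℝ) ^ 2 ≤ (H M : ℝ) ^ 2) ∧
        Tendsto (fun M : ℕ => productProbability M (H M) (fun K => ∃ d w : ℕ,
            K.code.HasParameters (M ^ 2) (H M ^ 2) d w ∧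
            c₂ * (M : ℝ) ^ 2 ≤ (d : ℝ) ∧ (w : ℝ) ≤ c₃ * (M : ℝ)))
          atTop (𝓝 1)) := by
  let H : ℕ → ℕ := fun M => M - 2 * (M / 4)
  have hH : ∀ M, 2 * (M / 4) + H M = M := fun M => by simp only [H]; omega
  have hHle : ∀ M : ℕ, (M : ℝ) / 2 ≤ H M := fun M => by
    have h1 : M ≤ 2 * H M := by simp only [H]; omega
    have h2 : (M : ℝ) ≤ 2 * H M := by exact_mod_cast h1
    linarith
  have hHge : ∀ M : ℕ, (H M : ℝ) ≤ M / 2 + 2 := fun M => by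
    have h1 : 2 * H M ≤ M + 4 := by simp only [H]; omega
    have h2 : 2 * (H M : ℝ) ≤ M + 4 := by exact_mod_cast h1
    linarith
  have hgood : ∀ M, 65536 ≤ M → ∀ K₁ K₂ : ComplexWithHomDim M (H M),
      ¬ HasLightCycle (M / 65536) K₁.1.δ K₂.1.δ →
      ¬ HasLightCycle (M / 65536) K₁.1.δ.transpose K₂.1.δ.transpose →
      ∃ d : ℕ, (1 / 65536 ^ 2 : ℝ) * (M : ℝ) ^ 2 ≤ d ∧
        (K₁.1.prod K₂.1).code.HasParameters (M ^ 2) (H M ^ 2) d (2 * M) := by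
    intro M hM K₁ K₂ h h'
    obtain ⟨d, hd, hpar⟩ := exists_hasParameters_prod (by simp only [H]; omega) K₁ K₂ h h'
    refine ⟨d, ?_, hpar⟩
    have h1 : M ≤ 65536 * (M / 65536 + 1) := by omega
    have h2 : (M : ℝ) ≤ 65536 * ((M / 65536 + 1 : ℕ) : ℝ) := by exact_mod_cast h1
    have h3 : (((M / 65536 + 1 : ℕ) : ℝ)) ^ 2 ≤ d := by exact_mod_cast hd
    have h4 : (M : ℝ) ^ 2 ≤ (65536 * ((M / 65536 + 1 : ℕ) : ℝ)) ^ 2 :=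
      pow_le_pow_left₀ (Nat.cast_nonneg M) h2 2
    rw [mul_pow] at h4
    rw [one_div, inv_mul_le_iff₀ (by norm_num)]
    linarith [mul_le_mul_of_nonneg_left h3 (show (0 : ℝ) ≤ 65536 ^ 2 by norm_num)]
  have hprob : ∀ M, 65536 ≤ M → ∀ P : BinaryComplex (Fin M × Fin M) → Prop,
      (∀ K₁ K₂ : ComplexWithHomDim M (H M), ¬ HasLightCycle (M / 65536) K₁.1.δ K₂.1.δ →
        ¬ HasLightCycle (M / 65536) K₁.1.δ.transpose K₂.1.δ.transpose → P (K₁.1.prod K₂.1)) →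
      1 - 8 * (1 / 2 : ℝ) ^ (12 * (M / 512)) ≤ productProbability M (H M) P := by
    intro M hM P hP
    -- Here L = M/4, a = M/65536 and b = M/512, rounded down. The entropy exponent 12a + 2(M/4096 +
    -- 1) is at most b, and 72b + 2 ≤ L.
    refine one_sub_le_productProbability (hH M) (by omega)
      ((card_lightVector_le M _).trans (Nat.pow_le_pow_right (by norm_num) (by omega))) ?_
      (by omega) P hP
    exact le_trans (by omega) (mul_succ_le_two_pow (b := M / 512) (by omega))
  -- With M = ⌊√n⌋ one has n ≤ 4M². Then H ≥ M/2 gives H² ≥ M²/4 ≥ n/16, and the distance bound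
  -- M²/65536² also loses a factor 4.
  refine ⟨1 / 16, 1 / 65536 ^ 2 / 4, 2, by norm_num, by norm_num, by norm_num, ?_, 1 / 2, H,
    by norm_num, ?_, ?_, ?_⟩
  · filter_upwards [eventually_ge_atTop (65536 ^ 2)] with n hn
    set M := Nat.sqrt n with hMdef
    have hM : 65536 ≤ M := by
      rw [hMdef, Nat.le_sqrt]; omega
    have hMn : M ^ 2 ≤ n := Nat.sqrt_le' n
    have hnM : n ≤ 4 * M ^ 2 := by
      have : n < (M + 1) ^ 2 := Nat.lt_succ_sqrt' n
      nlinarith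
    have hnM' : (n : ℝ) ≤ 4 * (M : ℝ) ^ 2 := by exact_mod_cast hnM
    obtain ⟨K₁, K₂, h, h'⟩ : ∃ K₁ K₂ : ComplexWithHomDim M (H M),
        ¬ HasLightCycle (M / 65536) K₁.1.δ K₂.1.δ ∧
        ¬ HasLightCycle (M / 65536) K₁.1.δ.transpose K₂.1.δ.transpose := by
      by_contra! hall
      -- If no good pair existed, the impossible event would have probability at least 1 - 8/16.
      have h1 := hprob M hM (fun _ => False) fun K₁ K₂ h h' => h' (hall K₁ K₂ h)
      have h2 : productProbability M (H M) (fun _ => False) = 0 := by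
        simp [productProbability]
      have h3 : (1 / 2 : ℝ) ^ (12 * (M / 512)) ≤ (1 / 2) ^ 4 :=
        pow_le_pow_of_le_one (by norm_num) (by norm_num) (by omega)
      rw [h2] at h1
      norm_num at h3
      linarith
    obtain ⟨d, hd, hpar⟩ := hgood M hM K₁ K₂ h h'
    obtain ⟨rX, rZ, C, hC⟩ := hpar.exists_of_le (by omega) hMn
    refine ⟨rX, rZ, C, _, _, _, hC, ?_, ?_, ?_⟩
    · have h1 := pow_le_pow_left₀ (by positivity) (hHle M) 2
      push_cast
      nlinarith
    · linarith
    · push_cast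
      have : (M : ℝ) ≤ √(n : ℝ) := Real.le_sqrt_of_sq_le (by exact_mod_cast hMn)
      linarith
  · have hlim : Tendsto (fun M : ℕ => (1 / 2 : ℝ) + 2 / (M : ℝ)) atTop (𝓝 (1 / 2)) := by
      simpa using (tendsto_const_div_atTop_nhds_zero_nat (2 : ℝ)).const_add (1 / 2 : ℝ)
    refine tendsto_of_tendsto_of_tendsto_of_le_of_le' tendsto_const_nhds hlim ?_ ?_
    · filter_upwards [eventually_gt_atTop 0] with M hM
      have : (0 : ℝ) < M := by exact_mod_cast hM
      rw [le_div_iff₀ this]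
      linarith [hHle M]
    · filter_upwards [eventually_gt_atTop 0] with M hM
      have : (0 : ℝ) < M := by exact_mod_cast hM
      rw [div_le_iff₀ this, add_mul, div_mul_cancel₀ _ this.ne']
      linarith [hHge M]
  · refine Eventually.of_forall fun M => ?_
    have h1 := pow_le_pow_left₀ (by positivity) (hHle M) 2
    nlinarith
  · have hlim : Tendsto (fun M : ℕ => 1 - 8 * (1 / 2 : ℝ) ^ (12 * (M / 512))) atTop (𝓝 1) := by
      have h1 : Tendsto (fun M : ℕ => 12 * (M / 512)) atTop atTop :=
        tendsto_atTop_mono (fun M => Nat.le_mul_of_pos_left _ (by norm_num))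
          (Nat.tendsto_div_const_atTop (by norm_num))
      have h2 := (tendsto_pow_atTop_nhds_zero_of_lt_one (r := (1 / 2 : ℝ)) (by norm_num)
        (by norm_num)).comp h1
      simpa using (h2.const_mul 8).const_sub 1
    refine tendsto_of_tendsto_of_tendsto_of_le_of_le' hlim tendsto_const_nhds ?_
      (Eventually.of_forall fun M => productProbability_le_one _ _ _)
    filter_upwards [eventually_ge_atTop 65536] with M hM
    refine hprob M hM _ fun K₁ K₂ h h' => ?_
    obtain ⟨d, hd, hpar⟩ := hgood M hM K₁ K₂ h h'
    refine ⟨d, 2 * M, hpar, le_trans ?_ hd, by push_cast; exact le_rfl⟩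
    have : (0 : ℝ) ≤ (M : ℝ) ^ 2 := by positivity
    linarith
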